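/- For $f \in L^2(\mathbb{R}, dx)$ (complex-valued), let $\widehat{f} \in L^2(\mathbb{R}, dx)$ be its Fourier transform, normalized by \[ \widehat{f}(\zeta) = \frac{1}{\sqrt{2\pi}} \int_{\mathbb{R}} f(x) e^{-ix\zeta}\, dx, \qquad \zeta \in \mathbb{R}, \] and understood in the sense of Plancherel's theorem. Let $\sigma(f) := \{ \zeta \in \mathbb{R} : |\widehat{f}(\zeta)| > 0 \}$, which is defined up to a set of Lebesgue measure zero. For a measurable function $g$ on $\mathbb{R}$ let $\rho_g(x) := \int_x^\infty |g(t)|\, dt \in [0,\infty]$. Integrals of $\log|g|$ are taken in the extended sense with the convention $\log 0 = -\infty$: for $g \in L^2(\mathbb{R}, dx)$ and a bounded interval $I$ the integral $\int_I \log |g(t)|\, dt \in [-\infty, \infty)$ is well defined, and it equals $-\infty$ if $g$ vanishes on a subset of $I$ of positive measure. (a) Let $f \in L^2(\mathbb{R}, dx)$. Suppose that for some constant $c > 0$ \[ \rho_f(x) = \mathcal{O}\big(e^{-c\sqrt{x}}\big), \qquad x > 0, \] that is, $\rho_f(x) \le C e^{-c\sqrt{x}}$ for all $x > 0$ with some constant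 $C$. Then there exists an open set $U \subseteq \mathbb{R}$ which coincides with $\sigma(f)$ up to a set of Lebesgue measure zero, and such that for every $x \in U$ there exists a bounded open interval $I$ containing $x$ with \[ \int_I \log |\widehat{f}(t)|\, dt > -\infty. \] (b) The same holds with the roles of $f$ and $\widehat{f}$ interchanged. Let $f \in L^2(\mathbb{R}, dx)$, and suppose that $\rho_{\widehat{f}}(\zeta) = \mathcal{O}\big(e^{-c\sqrt{\zeta}}\big)$, $\zeta > 0$, for some constant $c > 0$. Then there exists an open set $U \subseteq \mathbb{R}$ which coincides with $\{ x \in \mathbb{R} : |f(x)| > 0 \}$ up to a set of Lebesgue measure zero, and such that for every $x \in U$ there exists a bounded open interval $I$ containing $x$ with \[ \int_I \log |f(t)|\, dt > -\infty. \] -/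

import Mathlib

open MeasureTheory Set
open scoped ENNReal FourierTransform

noncomputable section

/-- The unitary Fourier transform on `L²(ℝ, dx)` in the angular frequency normalization,
`f̂(ζ) = (2π)^{-1/2} ∫ f(x) e^{-ixζ} dx`, understood through Plancherel's theorem.
Mathlib's transform `𝓕` on `L²` uses the kernel `e^{-2πixξ}` and Lebesgue measure, so that
`f̂(ζ) = (2π)^{-1/2} (𝓕 f)(ζ / 2π)`. As an element of `L²`, it is defined up to null sets; the
value here is a representative. -/
def angularFourier (f : Lp ℂ 2 (volume : Measure ℝ)) : ℝ → ℂ := fun ζ =>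
  (((Real.sqrt (2 * Real.pi))⁻¹ : ℝ) : ℂ) *
    (𝓕 f : Lp ℂ 2 (volume : Measure ℝ)) (ζ / (2 * Real.pi))

/-- The set on which a function lives, `{x : |g(x)| > 0}`. -/
def livingSet (g : ℝ → ℂ) : Set ℝ := {x | 0 < ‖g x‖}

/-- The spectrum `σ(f) = {ζ : |f̂(ζ)| > 0}`, which is defined up to null sets. -/
def spectrumSet (f : Lp ℂ 2 (volume : Measure ℝ)) : Set ℝ := livingSet (angularFourier f)

/-- `ρ_g(x) = ∫_x^∞ |g(t)| dt`, with values in `[0, ∞]`. -/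
def tailIntegral (g : ℝ → ℂ) (x : ℝ) : ℝ≥0∞ := ∫⁻ t in Ioi x, ‖g t‖ₑ

/-- The one-sided decay condition `ρ_g(x) = O(e^{-c√x})`, `x > 0`. -/
def HasOneSidedDecay (g : ℝ → ℂ) (c : ℝ) : Prop :=
  ∃ C : ℝ, ∀ x : ℝ, 0 < x →
    tailIntegral g x ≤ ENNReal.ofReal (C * Real.exp (-c * Real.sqrt x))

/-- The extended-real integral `∫_I log |g(t)| dt`, as the integral of the positive part minus
the integral of the negative part. Here `ENNReal.log 0 = ⊥`, i.e. `log 0 = -∞`, so that the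
integral is `-∞` as soon as `g` vanishes on a subset of `I` of positive measure. (In `EReal`,
`⊤ - ⊤ = ⊥`, so the integral is greater than `⊥` exactly when the negative part is integrable.) -/
def logIntegral (g : ℝ → ℂ) (I : Set ℝ) : EReal :=
  ((∫⁻ t in I, (ENNReal.log ‖g t‖ₑ).toENNReal : ℝ≥0∞) : EReal) -
    ((∫⁻ t in I, (-(ENNReal.log ‖g t‖ₑ)).toENNReal : ℝ≥0∞) : EReal)

end

/-!
Both parts say the same of a pair `F`, `g` in which `g` is the Fourier transform of `F`, where `F`
has the one-sided decay: for the second part, `F` is the transform of `f` and `g` is the reflection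
of `f` (`isFourierPair_angularFourier`, `isFourierPair_reflection`). Let `U` be the open set of
points with a neighbourhood on which `log⁻ |g|` is integrable. Clearly `g ≠ 0` almost everywhere on
`U`; what has to be shown is that `g = 0` almost everywhere on every compact subset `E` of the
complement (`ae_eq_zero_on_of_lintegral_negLog_eq_top`).

Every interval that meets `E` has `∫ log⁻ |g| = ∞`. Hence, on a fine grid, there is a density `u_n`
supported in the intervals near `E` with mean zero on each of them, which is at most
`log⁻ |g| - n` there (`exists_balanced_density_near`). Let `Ψ_n` be the outer function in the upper
half-plane with modulus `e^{u_n}` on the real line. There are two consequences.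

* On the line, `|g Ψ_n| ≤ e^{-n} (1 + |g|)` in these intervals, and `Ψ_n → 1` off `E`. So
  `1 - Ψ_n` tends to the indicator function of `E` with respect to the weight `|g|`.
* The primitive `V_n` of `u_n` is as small as desired, by the mean zero property. As
  `log Ψ_n (z) = (π i)⁻¹ ∫ V_n(t) (t - z)⁻² dt`, this gives `|log Ψ_n (z)| ≤ ε_n / Im z` with
  `ε_n → 0`.

By the second point and a shift of the line of integration, the Fourier transform of
`(1 - Ψ_n(t)) (t + i)⁻²` vanishes on one half-line and is at most a constant times
`exp (x y + ε_n / y)` at `x > 0`, for every `y > 0`. The choice `y = c / (4 √x)` bounds it by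
`e^{(c/2) √x}`, which is integrable against `F`; this is where the rate `e^{-c √x}` is used. Since
the transforms tend to zero pointwise, `∫ g (1 - Ψ_n) (t + i)⁻² e^{-ist} dt → 0` for every `s`
(`tendsto_integral_mul_outerTest`). By the first point the limit is the Fourier transform of
`1_E g (t + i)⁻²`, and so `g = 0` on `E`.

Boundary values of outer functions are avoided by a small shift into the half-plane. The real part
of `log Ψ_n` at `x + i η` is an average of difference quotients of the Lipschitz function `V_n` at
`x` (`re_logOuter`), so it is bounded, and it converges to `u_n(x)` as `η → 0` by the Lebesgue
differentiation theorem.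
-/

open Filter Topology SchwartzMap

/-! ### Balanced densities near a set without local log-integrability -/

/-- The negative part `log⁻ |g|` of `log |g|`, with the value `∞` where `g` vanishes. -/
noncomputable def negLog (g : ℝ → ℂ) (t : ℝ) : ℝ≥0∞ := (-(ENNReal.log ‖g t‖ₑ)).toENNReal

lemma measurable_negLog {g : ℝ → ℂ} (hg : Measurable g) : Measurable (negLog g) := by
  unfold negLog
  have := hg.enorm.ennreal_log
  fun_prop

/-- Where `log⁻ |g|` is at least `s`, the factor `e^s` still leaves `|g|` bounded by `1 + |g|`. -/
lemma norm_mul_exp_le {g : ℝ → ℂ} {t s : ℝ} (hs : ENNReal.ofReal s ≤ negLog g t) :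
    ‖g t‖ * Real.exp s ≤ 1 + ‖g t‖ := by
  rcases eq_or_ne (g t) 0 with h0 | h0
  · simp [h0]
  have hpos : 0 < ‖g t‖ := norm_pos_iff.2 h0
  have hlog : negLog g t = ENNReal.ofReal (-Real.log ‖g t‖) := by
    unfold negLog
    rw [← ofReal_norm, ENNReal.log_ofReal_of_pos hpos, ← EReal.coe_neg]
    rfl
  rw [hlog] at hs
  rcases le_or_gt s 0 with h | h
  · have := Real.exp_le_one_iff.2 h
    nlinarith
  · have h1 : s ≤ -Real.log ‖g t‖ := by
      by_contra hc
      push Not at hc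
      exact absurd hs (not_le.2 ((ENNReal.ofReal_lt_ofReal_iff h).2 hc))
    have h2 : Real.exp s ≤ (‖g t‖)⁻¹ := by
      calc Real.exp s ≤ Real.exp (-Real.log ‖g t‖) := Real.exp_le_exp.2 h1
        _ = _ := by rw [Real.exp_neg, Real.exp_log hpos]
    calc ‖g t‖ * Real.exp s ≤ ‖g t‖ * (‖g t‖)⁻¹ := by gcongr
      _ = 1 := mul_inv_cancel₀ hpos.ne'
      _ ≤ _ := by linarith

/-- Truncations of a function with infinite integral have arbitrarily large integrals. -/
lemma exists_trunc_lintegral_ge {l : ℝ → ℝ≥0∞} (hl : Measurable l) {S : Set ℝ}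
    (h : ∫⁻ t in S, l t = ⊤) {m : ℝ≥0∞} (hm : m < ⊤) :
    ∃ N : ℕ, m < ∫⁻ t in S, min (l t) N := by
  have h1 : ∫⁻ t in S, ⨆ N : ℕ, min (l t) (N : ℝ≥0∞) = ⨆ N : ℕ, ∫⁻ t in S, min (l t) N :=
    lintegral_iSup (fun N => hl.min measurable_const)
      (fun N M hNM t => min_le_min_left _ (by exact_mod_cast hNM))
  have h2 : ∀ t, ⨆ N : ℕ, min (l t) (N : ℝ≥0∞) = l t := fun t => by
    have : ⨆ N : ℕ, min (l t) (N : ℝ≥0∞) = min (l t) (⨆ N : ℕ, (N : ℝ≥0∞)) :=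
      (inf_iSup_eq _ _).symm
    rw [this, ENNReal.iSup_natCast, min_eq_left le_top]
  simp_rw [h2, h] at h1
  exact lt_iSup_iff.1 (h1 ▸ hm)

/-- On an interval where `log⁻ |g|` has infinite integral there is a mean zero density `u`, namely
`u = θ min(log⁻ |g|, N) - m` with a suitable `θ ∈ [0, 1]`, which is so negative wherever `|g|` is
not small that `|g| e^u` is small throughout. `V` is the primitive of `u`; that it vanishes at both
ends and is small is what makes the outer function with boundary modulus `e^u` close to `1` away
from the interval. -/
lemma exists_balanced_density {g : ℝ → ℂ} (hg : Measurable g) {a b : ℝ} (hab : a < b)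
    (h : ∫⁻ t in Ioo a b, negLog g t = ⊤) {m : ℝ} (hm : 0 ≤ m) :
    ∃ (V u : ℝ → ℝ) (K : ℝ), 0 ≤ K ∧ (∀ s t, |V s - V t| ≤ K * |s - t|) ∧
      (∀ t, |V t| ≤ m * (b - a)) ∧
      (∀ t ∉ Ioo a b, V t = 0) ∧ (∀ t ∉ Ioo a b, u t = 0) ∧ (∀ t, u t ≤ K) ∧ Measurable u ∧
      (∀ᵐ t, HasDerivAt V (u t) t) ∧
      ∀ t ∈ Ioo a b, ‖g t‖ * Real.exp (u t) ≤ Real.exp (-m) * (1 + ‖g t‖) := by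
  obtain ⟨N, hN⟩ := exists_trunc_lintegral_ge (measurable_negLog hg) h
    (m := ENNReal.ofReal (m * (b - a))) ENNReal.ofReal_lt_top
  set k : ℝ → ℝ := (Ioo a b).indicator fun t => (min (negLog g t) N).toReal with hk
  have hfin : ∀ t, min (negLog g t) (N : ℝ≥0∞) ≠ ⊤ := fun t =>
    ne_top_of_le_ne_top (ENNReal.natCast_ne_top N) (min_le_right _ _)
  have hkm : Measurable k :=
    (((measurable_negLog hg).min measurable_const).ennreal_toReal).indicator measurableSet_Ioo
  have hk0 : ∀ t, 0 ≤ k t := fun t => indicator_nonneg (fun _ _ => ENNReal.toReal_nonneg) t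
  have hkN : ∀ t, k t ≤ N := fun t => by
    refine indicator_apply_le' (fun _ => ?_) (fun _ => by positivity)
    simpa using ENNReal.toReal_mono (ENNReal.natCast_ne_top N) (min_le_right (negLog g t) N)
  have hkI : Integrable k := by
    rw [hk, integrable_indicator_iff measurableSet_Ioo]
    refine Measure.integrableOn_of_bounded (M := N) (by simp)
      ((measurable_negLog hg).min measurable_const).ennreal_toReal.aestronglyMeasurable ?_
    refine ae_of_all _ fun t => ?_
    rw [Real.norm_of_nonneg ENNReal.toReal_nonneg]
    simpa using ENNReal.toReal_mono (ENNReal.natCast_ne_top N) (min_le_right (negLog g t) N)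
  set J := ∫ t, k t with hJ
  have hJm : m * (b - a) < J := by
    have h1 : ENNReal.ofReal J = ∫⁻ t in Ioo a b, min (negLog g t) N := by
      rw [hJ, ofReal_integral_eq_lintegral_ofReal hkI (ae_of_all _ hk0),
        ← lintegral_indicator measurableSet_Ioo]
      refine lintegral_congr fun t => ?_
      by_cases ht : t ∈ Ioo a b
      · simp only [hk, indicator_of_mem ht, ENNReal.ofReal_toReal (hfin t)]
      · simp [hk, indicator_of_notMem ht]
    rw [← h1] at hN
    exact (ENNReal.ofReal_lt_ofReal_iff_of_nonneg (by nlinarith)).1 hN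
  have hJ0 : 0 < J := lt_of_le_of_lt (mul_nonneg hm (sub_pos.2 hab).le) hJm
  set θ := m * (b - a) / J with hθ
  have hθ0 : 0 ≤ θ := div_nonneg (mul_nonneg hm (sub_pos.2 hab).le) hJ0.le
  have hθ1 : θ ≤ 1 := (div_le_one hJ0).2 hJm.le
  have hθJ : θ * J = m * (b - a) := div_mul_cancel₀ _ hJ0.ne'
  set u : ℝ → ℝ := fun t => θ * k t - (Ioo a b).indicator (fun _ => m) t with hu
  have hind : Integrable ((Ioo a b).indicator (fun _ => m)) :=
    (integrable_indicator_iff measurableSet_Ioo).2 (by simp)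
  have huI : Integrable u := (hkI.const_mul θ).sub hind
  have huout : ∀ t ∉ Ioo a b, u t = 0 := fun t ht => by
    simp [hu, hk, indicator_of_notMem ht]
  have hui : ∀ c d, IntervalIntegrable u volume c d := fun c d => huI.intervalIntegrable
  set V : ℝ → ℝ := fun x => ∫ t in a..x, u t with hV
  have hub : ∀ t, |u t| ≤ N + m := fun t => by
    have h1 := hk0 t
    have h2 := hkN t
    have h3 : 0 ≤ (Ioo a b).indicator (fun _ => m) t := indicator_nonneg (fun _ _ => hm) t
    have h4 : (Ioo a b).indicator (fun _ => m) t ≤ m := indicator_le_self' (fun _ _ => hm) t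
    have h5 : θ * k t ≤ k t := mul_le_of_le_one_left h1 hθ1
    have h6 : 0 ≤ θ * k t := mul_nonneg hθ0 h1
    rw [hu, abs_le]
    constructor <;> simp only <;> nlinarith
  have hVa : ∀ x ≤ a, V x = 0 := fun x hx => by
    rw [hV]
    simp only
    rw [intervalIntegral.integral_symm, neg_eq_zero]
    refine intervalIntegral.integral_zero_ae (ae_of_all _ fun t ht => huout t ?_)
    rw [uIoc_of_le hx] at ht
    exact fun h' => absurd h'.1 (not_lt.2 ht.2)
  have htot : ∫ t, u t = 0 := by
    have e1 : ∫ t, θ * k t = θ * J := integral_const_mul _ _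
    have e2 : ∫ t, (Ioo a b).indicator (fun _ => m) t = m * (b - a) := by
      rw [integral_indicator measurableSet_Ioo]
      simp [hab.le, mul_comm]
    rw [hu, integral_sub (hkI.const_mul θ) hind, e1, e2, hθJ, sub_self]
  have hVset : ∀ x, a ≤ x → V x = ∫ t in Iic x, u t := fun x hx => by
    have h1 := intervalIntegral.integral_Iic_sub_Iic (a := a) (b := x) (μ := volume)
      huI.integrableOn huI.integrableOn
    have h2 : ∫ t in Iic a, u t = 0 :=
      setIntegral_eq_zero_of_forall_eq_zero fun t ht => huout t fun h' => absurd h'.1 (not_lt.2 ht)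
    rw [h2, sub_zero] at h1
    exact h1.symm
  have hVb : ∀ x, b ≤ x → V x = 0 := fun x hx => by
    rw [hVset x (hab.le.trans hx), setIntegral_eq_integral_of_forall_compl_eq_zero, htot]
    exact fun t ht => huout t fun h' => ht (h'.2.le.trans hx)
  have hVout : ∀ t ∉ Ioo a b, V t = 0 := fun t ht => by
    rcases le_or_gt t a with h1 | h1
    · exact hVa t h1
    · exact hVb t (not_lt.1 fun h2 => ht ⟨h1, h2⟩)
  refine ⟨V, u, N + m, by positivity, fun s t => ?_, fun t => ?_, hVout, huout,
    fun t => (le_abs_self _).trans (hub t), ?_, ?_, fun t ht => ?_⟩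
  · have : V s - V t = ∫ r in t..s, u r :=
      intervalIntegral.integral_interval_sub_left (hui _ _) (hui _ _)
    rw [this]
    exact intervalIntegral.norm_integral_le_of_norm_le_const (f := u) fun r _ => hub r
  · by_cases ht : t ∈ Ioo a b
    · have e1 : V t = θ * (∫ r in a..t, k r) - m * (t - a) := by
        have e2 : ∫ r in a..t, (Ioo a b).indicator (fun _ => m) r = m * (t - a) := by
          rw [intervalIntegral.integral_of_le ht.1.le]
          rw [setIntegral_congr_fun (g := fun _ => m) measurableSet_Ioc fun r hr =>
            indicator_of_mem (show r ∈ Ioo a b from ⟨hr.1, hr.2.trans_lt ht.2⟩) _]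
          simp [ht.1.le, mul_comm]
        rw [hV]
        simp only [hu]
        rw [intervalIntegral.integral_sub (hkI.const_mul θ).intervalIntegrable
          hind.intervalIntegrable, intervalIntegral.integral_const_mul, e2]
      have e3 : 0 ≤ ∫ r in a..t, k r :=
        intervalIntegral.integral_nonneg ht.1.le fun r _ => hk0 r
      have e4 : ∫ r in a..t, k r ≤ J := by
        rw [intervalIntegral.integral_of_le ht.1.le]
        exact setIntegral_le_integral hkI (ae_of_all _ hk0)
      have e5 : θ * (∫ r in a..t, k r) ≤ m * (b - a) :=
        hθJ ▸ mul_le_mul_of_nonneg_left e4 hθ0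
      have e6 : 0 ≤ θ * (∫ r in a..t, k r) := mul_nonneg hθ0 e3
      have e7 : m * (t - a) ≤ m * (b - a) := by
        have := ht.2.le
        gcongr
      have e8 : 0 ≤ m * (t - a) := mul_nonneg hm (by linarith [ht.1])
      rw [e1, abs_le]
      constructor <;> linarith
    · rw [hVout t ht, abs_zero]
      exact mul_nonneg hm (sub_pos.2 hab).le
  · exact (hkm.const_mul θ).sub (measurable_const.indicator measurableSet_Ioo)
  · filter_upwards [LocallyIntegrable.ae_hasDerivAt_integral huI.locallyIntegrable] with x hx
    exact hx a
  · have e1 : u t = θ * k t - m := by simp [hu, indicator_of_mem ht]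
    have e2 : ENNReal.ofReal (θ * k t) ≤ negLog g t := by
      calc ENNReal.ofReal (θ * k t) ≤ ENNReal.ofReal (k t) :=
            ENNReal.ofReal_le_ofReal (mul_le_of_le_one_left (hk0 t) hθ1)
        _ = min (negLog g t) N := by
            simp only [hk, indicator_of_mem ht, ENNReal.ofReal_toReal (hfin t)]
        _ ≤ _ := min_le_left _ _
    have e3 := norm_mul_exp_le e2
    rw [e1, sub_eq_add_neg, Real.exp_add]
    calc ‖g t‖ * (Real.exp (θ * k t) * Real.exp (-m))
        = Real.exp (-m) * (‖g t‖ * Real.exp (θ * k t)) := by ring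
      _ ≤ _ := by gcongr

/-- The intervals of a grid of mesh `δ` that meet the compact set `E` carry a common balanced
density. Almost every point of `E` lies in the interior of such an interval. -/
lemma exists_balanced_density_near {g : ℝ → ℂ} (hg : Measurable g) {E : Set ℝ} (hE : IsCompact E)
    (h : ∀ a b : ℝ, (Ioo a b ∩ E).Nonempty → ∫⁻ t in Ioo a b, negLog g t = ⊤)
    {n : ℝ} (hn : 1 ≤ n) :
    ∃ (V u : ℝ → ℝ) (K : ℝ), 0 ≤ K ∧ (∀ s t, |V s - V t| ≤ K * |s - t|) ∧
      (∀ t, |V t| ≤ n⁻¹) ∧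
      (∀ t ∉ Metric.cthickening n⁻¹ E, V t = 0) ∧ (∀ t, u t ≤ K) ∧ Measurable u ∧
      (∀ᵐ t, HasDerivAt V (u t) t) ∧
      ∀ᵐ t, (t ∉ E ∧ u t = 0) ∨
        ‖g t‖ * Real.exp (u t) ≤ Real.exp (-n) * (1 + ‖g t‖) := by
  classical
  have hn0 : 0 < n := by linarith
  -- A primitive is at most `n` times the mesh, which this choice makes equal to `1 / n`.
  set δ : ℝ := (n ^ 2)⁻¹ with hδ
  have hδ0 : 0 < δ := by positivity
  have hnδ : n * δ = n⁻¹ := by rw [hδ]; field_simp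
  have hδn : δ ≤ n⁻¹ := by
    rw [← hnδ]; nlinarith
  obtain ⟨R, hR⟩ := hE.isBounded.subset_closedBall 0
  set S : Finset ℤ := (Finset.Icc (⌊-R / δ⌋) (⌊R / δ⌋)).filter
    (fun k => (Icc (k * δ) ((k + 1) * δ) ∩ E).Nonempty ∧
      ∫⁻ t in Ioo (k * δ) ((k + 1) * δ), negLog g t = ⊤) with hS
  have hlen : ∀ k : ℤ, (k + 1) * δ - k * δ = δ := fun k => by ring
  have hcell : ∀ k : ℤ, ∃ (V u : ℝ → ℝ) (K : ℝ), k ∈ S → (0 ≤ K ∧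
      (∀ s t, |V s - V t| ≤ K * |s - t|) ∧
      (∀ t, |V t| ≤ n⁻¹) ∧
      (∀ t ∉ Ioo (k * δ) ((k + 1) * δ), V t = 0) ∧ (∀ t ∉ Ioo (k * δ) ((k + 1) * δ), u t = 0) ∧
      (∀ t, u t ≤ K) ∧ Measurable u ∧
      (∀ᵐ t, HasDerivAt V (u t) t) ∧
      ∀ t ∈ Ioo (k * δ) ((k + 1) * δ),
        ‖g t‖ * Real.exp (u t) ≤ Real.exp (-n) * (1 + ‖g t‖)) := fun k => by
    by_cases hk : k ∈ S
    · have hk2 := (Finset.mem_filter.1 hk).2.2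
      obtain ⟨V, u, K, H⟩ := exists_balanced_density hg
        (by linarith [hlen k] : (k : ℝ) * δ < (k + 1) * δ) hk2 hn0.le
      rw [hlen, hnδ] at H
      exact ⟨V, u, K, fun _ => H⟩
    · exact ⟨0, 0, 0, fun h' => absurd h' hk⟩
  choose V u K H using hcell
  have hmem : ∀ (t : ℝ) (k : ℤ), t ∈ Ioo (k * δ) ((k + 1) * δ) → k = ⌊t / δ⌋ := fun t k ht => by
    symm
    rw [Int.floor_eq_iff]
    constructor
    · rw [le_div_iff₀ hδ0]; exact ht.1.le
    · rw [div_lt_iff₀ hδ0]; exact ht.2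
  have hthick : ∀ k ∈ S, ∀ t ∈ Ioo (k * δ) ((k + 1) * δ), t ∈ Metric.cthickening n⁻¹ E := by
    intro k hk t ht
    obtain ⟨e, he1, he2⟩ := (Finset.mem_filter.1 hk).2.1
    refine Metric.mem_cthickening_of_dist_le t e _ _ he2 ?_
    rw [Real.dist_eq, abs_le]
    have := hlen k
    constructor <;> linarith [ht.1, ht.2, he1.1, he1.2]
  -- The intervals are disjoint, so that at each point at most one summand does not vanish.
  have hsumV : ∀ t, ∑ k ∈ S, V k t = if ⌊t / δ⌋ ∈ S then V ⌊t / δ⌋ t else 0 := fun t => by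
    rw [← Finset.sum_ite_eq S ⌊t / δ⌋ (fun k => V k t)]
    refine Finset.sum_congr rfl fun k hk => ?_
    split_ifs with hkt
    · rfl
    · exact (H k hk).2.2.2.1 t fun ht => hkt (hmem t k ht).symm
  have hsumu : ∀ t, ∑ k ∈ S, u k t = if ⌊t / δ⌋ ∈ S then u ⌊t / δ⌋ t else 0 := fun t => by
    rw [← Finset.sum_ite_eq S ⌊t / δ⌋ (fun k => u k t)]
    refine Finset.sum_congr rfl fun k hk => ?_
    split_ifs with hkt
    · rfl
    · exact (H k hk).2.2.2.2.1 t fun ht => hkt (hmem t k ht).symm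
  refine ⟨fun t => ∑ k ∈ S, V k t, fun t => ∑ k ∈ S, u k t, ∑ k ∈ S, K k,
    Finset.sum_nonneg fun k hk => (H k hk).1, fun s t => ?_, fun t => ?_, fun t ht => ?_,
    fun t => Finset.sum_le_sum fun k hk => (H k hk).2.2.2.2.2.1 t,
    Finset.measurable_sum _ fun k hk => (H k hk).2.2.2.2.2.2.1, ?_, ?_⟩
  · rw [← Finset.sum_sub_distrib, Finset.sum_mul]
    exact (Finset.abs_sum_le_sum_abs _ _).trans (Finset.sum_le_sum fun k hk => (H k hk).2.1 s t)
  · simp only [hsumV]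
    split_ifs with hk
    · exact (H _ hk).2.2.1 t
    · simpa using hn0.le
  · exact Finset.sum_eq_zero fun k hk => (H k hk).2.2.2.1 t fun h' => ht (hthick k hk t h')
  · have : ∀ᵐ t, ∀ k ∈ S, HasDerivAt (V k) (u k t) t :=
      (ae_ball_iff S.countable_toSet).2 fun k hk => (H k hk).2.2.2.2.2.2.2.1
    filter_upwards [this] with t ht
    exact HasDerivAt.fun_sum ht
  · have hgrid : ∀ᵐ t : ℝ, t ∉ range fun k : ℤ => (k : ℝ) * δ :=
      measure_eq_zero_iff_ae_notMem.1 ((countable_range _).measure_zero volume)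
    filter_upwards [hgrid] with t ht
    have htI : t ∈ Ioo ((⌊t / δ⌋ : ℝ) * δ) ((⌊t / δ⌋ + 1) * δ) := by
      refine ⟨lt_of_le_of_ne ((le_div_iff₀ hδ0).1 (Int.floor_le _)) fun h' => ht ⟨_, h'⟩,
        (div_lt_iff₀ hδ0).1 (Int.lt_floor_add_one _)⟩
    simp only [hsumu]
    by_cases hk : ⌊t / δ⌋ ∈ S
    · rw [if_pos hk]
      exact Or.inr ((H _ hk).2.2.2.2.2.2.2.2 t htI)
    · rw [if_neg hk]
      refine Or.inl ⟨fun htE => hk ?_, rfl⟩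
      have hb := hR htE
      rw [Metric.mem_closedBall, dist_zero_right, Real.norm_eq_abs, abs_le] at hb
      refine Finset.mem_filter.2 ⟨Finset.mem_Icc.2 ⟨Int.floor_le_floor ?_, Int.floor_le_floor ?_⟩,
        ⟨t, Ioo_subset_Icc_self htI, htE⟩, h _ _ ⟨t, htI, htE⟩⟩
      · exact div_le_div_of_nonneg_right hb.1 hδ0.le
      · exact div_le_div_of_nonneg_right hb.2 hδ0.le

/-! ### The logarithm of an outer function -/

/-- `(π i)⁻¹ ∫ V(t) (t - z)⁻² dt`. If `V` is a primitive of `u`, integration by parts shows that the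
exponential of this function is the outer function in the upper half-plane with boundary modulus
`e^u`. -/
noncomputable def logOuter (V : ℝ → ℝ) (z : ℂ) : ℂ :=
  (Real.pi * Complex.I)⁻¹ * ∫ t : ℝ, (V t : ℂ) * (((t : ℂ) - z) ^ 2)⁻¹

lemma norm_ofReal_sub_sq (t : ℝ) (z : ℂ) : ‖(t : ℂ) - z‖ ^ 2 = (t - z.re) ^ 2 + z.im ^ 2 := by
  rw [← Complex.normSq_eq_norm_sq, Complex.normSq_apply]
  simp
  ring

lemma inv_norm_sq_eq (t : ℝ) {z : ℂ} (hz : 0 < z.im) :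
    (‖(t : ℂ) - z‖ ^ 2)⁻¹ = (z.im ^ 2)⁻¹ * (1 + (z.im⁻¹ * (t - z.re)) ^ 2)⁻¹ := by
  rw [norm_ofReal_sub_sq, ← mul_inv]
  congr 1
  field_simp
  ring

lemma integrable_inv_norm_sq {z : ℂ} (hz : 0 < z.im) :
    Integrable fun t : ℝ => (‖(t : ℂ) - z‖ ^ 2)⁻¹ := by
  simp_rw [inv_norm_sq_eq _ hz]
  exact (((integrable_inv_one_add_sq.comp_mul_left' (inv_ne_zero hz.ne')).comp_sub_right
    z.re)).const_mul _

lemma integral_inv_norm_sq {z : ℂ} (hz : 0 < z.im) :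
    ∫ t : ℝ, (‖(t : ℂ) - z‖ ^ 2)⁻¹ = Real.pi / z.im := by
  simp_rw [inv_norm_sq_eq _ hz]
  rw [integral_const_mul, integral_sub_right_eq_self (fun t => (1 + (z.im⁻¹ * t) ^ 2)⁻¹) z.re,
    Measure.integral_comp_mul_left (fun t => (1 + t ^ 2)⁻¹), integral_univ_inv_one_add_sq,
    abs_of_pos (by positivity)]
  simp only [inv_inv, smul_eq_mul]
  field_simp

lemma norm_kernel_le {V : ℝ → ℝ} {ε : ℝ} (hV : ∀ t, |V t| ≤ ε) (z : ℂ) (t : ℝ) :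
    ‖(V t : ℂ) * (((t : ℂ) - z) ^ 2)⁻¹‖ ≤ ε * (‖(t : ℂ) - z‖ ^ 2)⁻¹ := by
  rw [norm_mul, norm_inv, norm_pow, Complex.norm_real]
  exact mul_le_mul_of_nonneg_right (hV t) (by positivity)

lemma aestronglyMeasurable_kernel {V : ℝ → ℝ} (hc : Continuous V) (z : ℂ) (m : ℕ) :
    AEStronglyMeasurable (fun t : ℝ => (V t : ℂ) * (((t : ℂ) - z) ^ m)⁻¹) := by
  have : Measurable V := hc.measurable
  exact (by fun_prop : Measurable _).aestronglyMeasurable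

lemma integrable_kernel {V : ℝ → ℝ} (hc : Continuous V) {ε : ℝ} (hV : ∀ t, |V t| ≤ ε) {z : ℂ}
    (hz : 0 < z.im) : Integrable fun t : ℝ => (V t : ℂ) * (((t : ℂ) - z) ^ 2)⁻¹ :=
  ((integrable_inv_norm_sq hz).const_mul ε).mono' (aestronglyMeasurable_kernel hc z 2)
    (ae_of_all _ (norm_kernel_le hV z))

lemma norm_logOuter_le_of_integral {V : ℝ → ℝ} {z : ℂ} {B : ℝ}
    (h : ‖∫ t : ℝ, (V t : ℂ) * (((t : ℂ) - z) ^ 2)⁻¹‖ ≤ Real.pi * B) : ‖logOuter V z‖ ≤ B := by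
  rw [logOuter, norm_mul, norm_inv, norm_mul, Complex.norm_I, mul_one, Complex.norm_real,
    Real.norm_of_nonneg Real.pi_pos.le]
  calc Real.pi⁻¹ * _ ≤ Real.pi⁻¹ * (Real.pi * B) := by gcongr
    _ = B := by rw [inv_mul_cancel_left₀ Real.pi_pos.ne']

lemma norm_logOuter_le {V : ℝ → ℝ} {ε : ℝ} (hV : ∀ t, |V t| ≤ ε) {z : ℂ} (hz : 0 < z.im) :
    ‖logOuter V z‖ ≤ ε / z.im := by
  refine norm_logOuter_le_of_integral ?_
  calc _ ≤ ∫ t : ℝ, ε * (‖(t : ℂ) - z‖ ^ 2)⁻¹ :=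
        norm_integral_le_of_norm_le ((integrable_inv_norm_sq hz).const_mul ε)
          (ae_of_all _ (norm_kernel_le hV z))
    _ = _ := by rw [integral_const_mul, integral_inv_norm_sq hz]; ring

/-- Up to the boundary, `logOuter V` is small at a distance from the support of `V`. -/
lemma norm_logOuter_le_of_eq_zero {V : ℝ → ℝ} {ε : ℝ} (hV : ∀ t, |V t| ≤ ε) {z : ℂ}
    (hz : 0 < z.im) {d : ℝ} (hd : 0 < d) (h0 : ∀ t, |t - z.re| < d → V t = 0) :
    ‖logOuter V z‖ ≤ 2 * ε / d := by
  have hε : 0 ≤ ε := (abs_nonneg _).trans (hV 0)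
  set w : ℂ := ⟨z.re, d⟩ with hw
  have hwim : 0 < w.im := hd
  refine norm_logOuter_le_of_integral ?_
  calc _ ≤ ∫ t : ℝ, 2 * ε * (‖(t : ℂ) - w‖ ^ 2)⁻¹ := by
        refine norm_integral_le_of_norm_le ((integrable_inv_norm_sq hwim).const_mul _)
          (ae_of_all _ fun t => ?_)
        by_cases ht : |t - z.re| < d
        · rw [h0 t ht]
          simp only [Complex.ofReal_zero, zero_mul, norm_zero]
          positivity
        · refine (norm_kernel_le hV z t).trans ?_
          rw [mul_comm 2 ε, mul_assoc]
          refine mul_le_mul_of_nonneg_left ?_ hε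
          rw [norm_ofReal_sub_sq, norm_ofReal_sub_sq]
          have h1 : d ^ 2 ≤ (t - z.re) ^ 2 := by
            rw [← sq_abs (t - z.re)]
            exact pow_le_pow_left₀ hd.le (not_lt.1 ht) 2
          have h2 : 0 < d ^ 2 := by positivity
          have h3 : 0 < z.im ^ 2 := by positivity
          simp only [hw]
          rw [← div_eq_mul_inv, inv_eq_one_div, div_le_div_iff₀ (by positivity) (by positivity)]
          nlinarith
    _ = _ := by rw [integral_const_mul, integral_inv_norm_sq hwim]; simp only [hw]; ring

lemma differentiableAt_logOuter {V : ℝ → ℝ} (hc : Continuous V) {ε : ℝ} (hV : ∀ t, |V t| ≤ ε)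
    {z : ℂ} (hz : 0 < z.im) : DifferentiableAt ℂ (logOuter V) z := by
  have hε : 0 ≤ ε := (abs_nonneg _).trans (hV 0)
  have hfar : ∀ w ∈ Metric.ball z (z.im / 2), ∀ t : ℝ, 0 < ‖(t : ℂ) - z‖ ∧
      ‖(t : ℂ) - z‖ / 2 ≤ ‖(t : ℂ) - w‖ ∧ z.im / 2 ≤ ‖(t : ℂ) - w‖ := fun w hw t => by
    have h1 : z.im ≤ ‖(t : ℂ) - z‖ := by
      have := Complex.abs_im_le_norm ((t : ℂ) - z)
      simp only [Complex.sub_im, Complex.ofReal_im, zero_sub, abs_neg] at this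
      exact (le_abs_self _).trans this
    have h2 : ‖(t : ℂ) - z‖ ≤ ‖(t : ℂ) - w‖ + ‖w - z‖ := norm_sub_le_norm_sub_add_norm_sub _ _ _
    rw [Metric.mem_ball, dist_eq_norm] at hw
    refine ⟨hz.trans_le h1, ?_, ?_⟩ <;> linarith
  refine DifferentiableAt.const_mul (HasDerivAt.differentiableAt
    (hasDerivAt_integral_of_dominated_loc_of_deriv_le
      (F' := fun w t => (V t : ℂ) * (2 * (((t : ℂ) - w) ^ 3)⁻¹))
      (bound := fun t : ℝ => 16 * ε / z.im * (‖(t : ℂ) - z‖ ^ 2)⁻¹)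
      (Metric.ball_mem_nhds z (half_pos hz)) ?_ (integrable_kernel hc hV hz) ?_ ?_
      ((integrable_inv_norm_sq hz).const_mul _) ?_).2) _
  · exact Eventually.of_forall fun w => aestronglyMeasurable_kernel hc w 2
  · have := (aestronglyMeasurable_kernel hc z 3).const_mul 2
    refine this.congr (ae_of_all _ fun t => ?_)
    simp only
    ring
  · refine ae_of_all _ fun t w hw => ?_
    obtain ⟨h0, h1, h2⟩ := hfar w hw t
    rw [norm_mul, norm_mul, norm_inv, norm_pow, Complex.norm_real, Complex.norm_two]
    have h3 : (‖(t : ℂ) - w‖ ^ 3)⁻¹ ≤ 8 / z.im * (‖(t : ℂ) - z‖ ^ 2)⁻¹ := by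
      have h4 : z.im / 2 * (‖(t : ℂ) - z‖ / 2) ^ 2 ≤ ‖(t : ℂ) - w‖ ^ 3 := by
        rw [pow_succ' _ 2]
        gcongr
      calc (‖(t : ℂ) - w‖ ^ 3)⁻¹ ≤ (z.im / 2 * (‖(t : ℂ) - z‖ / 2) ^ 2)⁻¹ :=
            inv_anti₀ (by positivity) h4
        _ = _ := by field_simp; norm_num
    calc |V t| * (2 * (‖(t : ℂ) - w‖ ^ 3)⁻¹) ≤ ε * (2 * (8 / z.im * (‖(t : ℂ) - z‖ ^ 2)⁻¹)) := by
          have := hV t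
          gcongr
      _ = _ := by ring
  · refine ae_of_all _ fun t w hw => ?_
    have h0 : (t : ℂ) - w ≠ 0 := norm_pos_iff.1 ((half_pos hz).trans_le (hfar w hw t).2.2)
    have h1 : HasDerivAt (fun w : ℂ => ((t : ℂ) - w) ^ 2) (2 * ((t : ℂ) - w) * (-1)) w := by
      simpa using ((hasDerivAt_id w).const_sub (t : ℂ)).fun_pow 2
    convert! (h1.inv (pow_ne_zero 2 h0)).const_mul (V t : ℂ) using 1
    field_simp

/-- The kernel `(2 / π) σ / (1 + σ²)²`, the derivative of the Poisson kernel of height one up to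
sign. -/
noncomputable def poissonDeriv (s : ℝ) : ℝ := 2 / Real.pi * (s / (1 + s ^ 2) ^ 2)

lemma measurable_poissonDeriv : Measurable poissonDeriv := by
  unfold poissonDeriv; fun_prop

lemma abs_mul_poissonDeriv (s : ℝ) : |s| * |poissonDeriv s| = s * poissonDeriv s := by
  rw [← abs_mul, abs_of_nonneg]
  have : s * poissonDeriv s = 2 / Real.pi * (s ^ 2 / (1 + s ^ 2) ^ 2) := by
    unfold poissonDeriv; ring
  rw [this]
  have := Real.pi_pos
  positivity

lemma integrable_mul_poissonDeriv : Integrable fun s => s * poissonDeriv s := by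
  refine (integrable_inv_one_add_sq.const_mul (2 / Real.pi)).mono'
    (measurable_id.mul measurable_poissonDeriv).aestronglyMeasurable (ae_of_all _ fun s => ?_)
  rw [← abs_mul_poissonDeriv, Real.norm_of_nonneg (by positivity), abs_mul_poissonDeriv]
  have : s * poissonDeriv s = 2 / Real.pi * (s ^ 2 / (1 + s ^ 2) ^ 2) := by
    unfold poissonDeriv; ring
  rw [this]
  have := Real.pi_pos
  refine mul_le_mul_of_nonneg_left ?_ (by positivity)
  rw [inv_eq_one_div, div_le_div_iff₀ (by positivity) (by positivity)]
  nlinarith [sq_nonneg s]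

lemma integral_mul_poissonDeriv : ∫ s, s * poissonDeriv s = 1 := by
  have hder : ∀ s : ℝ, HasDerivAt
      (fun s : ℝ => Real.pi⁻¹ * (Real.arctan s - s / (1 + s ^ 2))) (s * poissonDeriv s) s := by
    intro s
    have h0 : (1 + s ^ 2) ≠ 0 := by positivity
    have h1 : HasDerivAt (fun s : ℝ => 1 + s ^ 2) (2 * s) s := by
      simpa using (hasDerivAt_pow 2 s).const_add 1
    convert! ((Real.hasDerivAt_arctan s).sub ((hasDerivAt_id s).div h1 h0)).const_mul Real.pi⁻¹
      using 1
    unfold poissonDeriv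
    have := Real.pi_ne_zero
    simp only [id]
    field_simp
    ring
  have hlim : ∀ l : Filter ℝ, Tendsto (fun s : ℝ => |s|) l atTop →
      Tendsto (fun s : ℝ => s / (1 + s ^ 2)) l (𝓝 0) := by
    intro l hl
    refine squeeze_zero_norm (a := fun s => |s|⁻¹) (fun s => ?_) hl.inv_tendsto_atTop
    rcases eq_or_ne s 0 with rfl | hs
    · simp
    have : 0 < |s| := abs_pos.2 hs
    rw [Real.norm_eq_abs, abs_div, abs_of_pos (by positivity : 0 < 1 + s ^ 2), ← sq_abs,
      inv_eq_one_div, div_le_div_iff₀ (by positivity) this]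
    nlinarith
  have hbot := ((Real.tendsto_arctan_atBot.mono_right nhdsWithin_le_nhds).sub
    (hlim _ tendsto_abs_atBot_atTop)).const_mul Real.pi⁻¹
  have htop := ((Real.tendsto_arctan_atTop.mono_right nhdsWithin_le_nhds).sub
    (hlim _ tendsto_abs_atTop_atTop)).const_mul Real.pi⁻¹
  rw [integral_of_hasDerivAt_of_tendsto hder integrable_mul_poissonDeriv hbot htop]
  have := Real.pi_ne_zero
  field_simp
  ring

/-- The real part of `logOuter V` as an average of difference quotients of `V`: the kernel
`σ * poissonDeriv σ` has integral one. -/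
lemma re_logOuter {V : ℝ → ℝ} (hc : Continuous V) {ε : ℝ} (hV : ∀ t, |V t| ≤ ε) (x : ℝ) {η : ℝ}
    (hη : 0 < η) : (logOuter V (x + η * Complex.I)).re =
      ∫ s, (V (x + η * s) - V x) / η * poissonDeriv s := by
  set z : ℂ := x + η * Complex.I with hz
  have hzim : z.im = η := by simp [hz]
  have hzpos : 0 < z.im := by rw [hzim]; exact hη
  have hpt : ∀ s : ℝ, ((Real.pi * Complex.I)⁻¹ *
      ((V (x + η * s) : ℂ) * ((((x + η * s : ℝ) : ℂ) - z) ^ 2)⁻¹)).re =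
      η⁻¹ * (V (x + η * s) / η * poissonDeriv s) := by
    intro s
    have h1 : ((x + η * s : ℝ) : ℂ) - z = η * (s - Complex.I) := by
      rw [hz]; push_cast; ring
    have h2 : ((s : ℂ) - Complex.I) ≠ 0 := fun h => by
      have := congrArg Complex.im h
      simp at this
    have h3 : ((s : ℂ) + Complex.I) ≠ 0 := fun h => by
      have := congrArg Complex.im h
      simp at this
    have h4 : ((1 + s ^ 2 : ℝ) : ℂ) = (s - Complex.I) * (s + Complex.I) := by
      push_cast
      linear_combination Complex.I_sq
    have h5 : (Real.pi * Complex.I)⁻¹ *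
      ((V (x + η * s) : ℂ) * ((((x + η * s : ℝ) : ℂ) - z) ^ 2)⁻¹) =
        ((η⁻¹ * (V (x + η * s) / η * (Real.pi⁻¹ * ((1 + s ^ 2) ^ 2)⁻¹)) : ℝ) : ℂ) *
          (2 * s + (1 - s ^ 2 : ℝ) * Complex.I) := by
      have h6 : (2 * (s : ℂ) + (1 - s ^ 2 : ℝ) * Complex.I) =
          -Complex.I * (s + Complex.I) ^ 2 := by
        push_cast
        linear_combination (2 * (s : ℂ) + Complex.I) * Complex.I_sq
      rw [h1, h6, Complex.ofReal_mul, Complex.ofReal_mul, Complex.ofReal_mul, Complex.ofReal_inv,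
        Complex.ofReal_inv, Complex.ofReal_inv, Complex.ofReal_pow, h4, Complex.ofReal_div, mul_inv,
        Complex.inv_I]
      have : (η : ℂ) ≠ 0 := by exact_mod_cast hη.ne'
      have : (Real.pi : ℂ) ≠ 0 := by exact_mod_cast Real.pi_ne_zero
      field_simp
    rw [h5, Complex.re_ofReal_mul]
    simp only [Complex.add_re, Complex.mul_re, Complex.ofReal_re, Complex.ofReal_im, Complex.I_re,
      Complex.I_im, Complex.re_ofNat, Complex.im_ofNat]
    unfold poissonDeriv
    ring
  have hker : Integrable fun t : ℝ =>
      ((Real.pi * Complex.I)⁻¹ * ((V t : ℂ) * (((t : ℂ) - z) ^ 2)⁻¹)) :=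
    (integrable_kernel hc hV hzpos).const_mul _
  have hsub : ∀ G : ℝ → ℝ, ∫ t, G t = η * ∫ s, G (x + η * s) := fun G => by
    rw [Measure.integral_comp_mul_left (fun s => G (x + s)), integral_add_left_eq_self G,
      abs_of_pos (by positivity), smul_eq_mul, mul_inv_cancel_left₀ hη.ne']
  have hI : Integrable fun s => V (x + η * s) / η * poissonDeriv s := by
    have h1 := ((hker.re.comp_add_left x).comp_mul_left' hη.ne').const_mul η
    refine h1.congr (ae_of_all _ fun s => ?_)
    simp only
    have := hpt s
    rw [show RCLike.re _ = _ from this, mul_inv_cancel_left₀ hη.ne']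
  have hP : Integrable poissonDeriv := by
    refine (integrable_inv_one_add_sq.const_mul (2 / Real.pi)).mono'
      measurable_poissonDeriv.aestronglyMeasurable (ae_of_all _ fun s => ?_)
    have := Real.pi_pos
    unfold poissonDeriv
    rw [norm_mul, Real.norm_of_nonneg (by positivity : 0 ≤ 2 / Real.pi), norm_div,
      Real.norm_of_nonneg (by positivity : 0 ≤ (1 + s ^ 2) ^ 2)]
    refine mul_le_mul_of_nonneg_left ?_ (by positivity)
    rw [inv_eq_one_div, div_le_div_iff₀ (by positivity) (by positivity), Real.norm_eq_abs,
      ← sq_abs s]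
    nlinarith [sq_nonneg (|s| - 1), abs_nonneg s, mul_nonneg (sq_nonneg |s|) (sq_nonneg |s|),
      sq_nonneg (|s|)]
  have hodd : ∫ s, poissonDeriv s = 0 := by
    have h1 : ∫ s, poissonDeriv (-s) = ∫ s, poissonDeriv s := integral_neg_eq_self _ _
    have h2 : ∀ s, poissonDeriv (-s) = -poissonDeriv s := fun s => by
      unfold poissonDeriv; rw [neg_sq]; ring
    simp_rw [h2, integral_neg] at h1
    linarith
  calc (logOuter V z).re
      = ∫ t : ℝ, ((Real.pi * Complex.I)⁻¹ * ((V t : ℂ) * (((t : ℂ) - z) ^ 2)⁻¹)).re := by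
        rw [logOuter, ← integral_const_mul]
        exact (integral_re hker).symm
    _ = ∫ s, V (x + η * s) / η * poissonDeriv s := by
        rw [hsub]
        simp_rw [hpt]
        rw [integral_const_mul, mul_inv_cancel_left₀ hη.ne']
    _ = (∫ s, V (x + η * s) / η * poissonDeriv s) - ∫ s, V x / η * poissonDeriv s := by
        rw [integral_const_mul, hodd, mul_zero, sub_zero]
    _ = _ := by
        rw [← integral_sub hI (hP.const_mul _)]
        refine integral_congr_ae (ae_of_all _ fun s => ?_)
        simp only
        ring

lemma abs_diffQuot_mul_le {V : ℝ → ℝ} {K : ℝ} (hL : ∀ s t, |V s - V t| ≤ K * |s - t|) (x : ℝ)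
    {η : ℝ} (hη : 0 < η) (s : ℝ) :
    ‖(V (x + η * s) - V x) / η * poissonDeriv s‖ ≤ K * (s * poissonDeriv s) := by
  have h1 : |(V (x + η * s) - V x) / η| ≤ K * |s| := by
    rw [abs_div, abs_of_pos hη, div_le_iff₀ hη]
    calc _ ≤ K * |x + η * s - x| := hL _ _
      _ = K * |s| * η := by rw [add_sub_cancel_left, abs_mul, abs_of_pos hη]; ring
  rw [norm_mul, ← abs_mul_poissonDeriv, ← mul_assoc]
  exact mul_le_mul_of_nonneg_right h1 (abs_nonneg _)

lemma re_logOuter_le {V : ℝ → ℝ} (hc : Continuous V) {ε : ℝ} (hV : ∀ t, |V t| ≤ ε) {K : ℝ}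
    (hL : ∀ s t, |V s - V t| ≤ K * |s - t|) (x : ℝ) {η : ℝ} (hη : 0 < η) :
    (logOuter V (x + η * Complex.I)).re ≤ K := by
  rw [re_logOuter hc hV x hη]
  calc _ ≤ ‖∫ s, (V (x + η * s) - V x) / η * poissonDeriv s‖ := Real.le_norm_self _
    _ ≤ ∫ s, K * (s * poissonDeriv s) :=
        norm_integral_le_of_norm_le (integrable_mul_poissonDeriv.const_mul K)
          (ae_of_all _ (abs_diffQuot_mul_le hL x hη))
    _ = K := by rw [integral_const_mul, integral_mul_poissonDeriv, mul_one]

lemma tendsto_re_logOuter {V : ℝ → ℝ} (hc : Continuous V) {ε : ℝ} (hV : ∀ t, |V t| ≤ ε) {K : ℝ}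
    (hL : ∀ s t, |V s - V t| ≤ K * |s - t|) {x u : ℝ} (hu : HasDerivAt V u x) :
    Tendsto (fun η : ℝ => (logOuter V (x + η * Complex.I)).re) (𝓝[>] 0) (𝓝 u) := by
  have h1 : Tendsto (fun η : ℝ => ∫ s, (V (x + η * s) - V x) / η * poissonDeriv s) (𝓝[>] 0)
      (𝓝 (∫ s, u * (s * poissonDeriv s))) := by
    refine tendsto_integral_filter_of_dominated_convergence (fun s => K * (s * poissonDeriv s))
      (Eventually.of_forall fun η => ?_) ?_ (integrable_mul_poissonDeriv.const_mul K)
      (ae_of_all _ fun s => ?_)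
    · exact (Measurable.mul (Continuous.measurable (by fun_prop))
        measurable_poissonDeriv).aestronglyMeasurable
    · filter_upwards [self_mem_nhdsWithin] with η hη
      exact ae_of_all _ (abs_diffQuot_mul_le hL x hη)
    · have h2 : HasDerivAt (fun η : ℝ => V (x + η * s)) (u * s) 0 := by
        have h3 : HasDerivAt (fun η : ℝ => x + η * s) s 0 := by
          simpa using ((hasDerivAt_id (0 : ℝ)).mul_const s).const_add x
        have h4 : HasDerivAt V u (x + 0 * s) := by simpa using hu
        exact h4.comp 0 h3
      have h5 := h2.tendsto_slope.mono_left (nhdsWithin_mono 0 fun η (hη : 0 < η) => hη.ne')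
      rw [← mul_assoc]
      refine (h5.congr fun η => ?_).mul_const _
      rw [slope_def_field]
      simp
  rw [integral_const_mul, integral_mul_poissonDeriv, mul_one] at h1
  refine h1.congr' ?_
  filter_upwards [self_mem_nhdsWithin] with η hη
  exact (re_logOuter hc hV x hη).symm

/-! ### Analytic test functions and their Fourier integrals -/

/-- Cauchy's theorem for a horizontal strip: the integral over a horizontal line does not depend on
the height of the line. -/
lemma integral_eq_integral_add_mul_I {G : ℂ → ℂ} {y C : ℝ} (hy : 0 ≤ y)
    (hd : ∀ z : ℂ, 0 ≤ z.im → z.im ≤ y → DifferentiableAt ℂ G z)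
    (hb : ∀ z : ℂ, 0 ≤ z.im → z.im ≤ y → ‖G z‖ ≤ C * (1 + z.re ^ 2)⁻¹) :
    ∫ t : ℝ, G t = ∫ t : ℝ, G (t + y * Complex.I) := by
  have hline : ∀ s : ℝ, 0 ≤ s → s ≤ y → Integrable fun t : ℝ => G (t + s * Complex.I) := by
    intro s hs hsy
    have hc : Continuous fun t : ℝ => G (t + s * Complex.I) := by
      refine continuous_iff_continuousAt.2 fun t => ?_
      exact ContinuousAt.comp (f := fun t : ℝ => (t : ℂ) + s * Complex.I)
        (hd _ (by simpa using hs) (by simpa using hsy)).continuousAt (by fun_prop)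
    refine (integrable_inv_one_add_sq.const_mul C).mono' hc.aestronglyMeasurable
      (ae_of_all _ fun t => ?_)
    simpa using hb (t + s * Complex.I) (by simpa using hs) (by simpa using hsy)
  have h0 : Integrable fun t : ℝ => G t := by simpa using hline 0 le_rfl hy
  have hside : ∀ s : ℝ, ‖∫ r in (0 : ℝ)..y, G (s + r * Complex.I)‖ ≤ C * (1 + s ^ 2)⁻¹ * y := by
    intro s
    have := intervalIntegral.norm_integral_le_of_norm_le_const (a := 0) (b := y)
      (f := fun r : ℝ => G (s + r * Complex.I)) (C := C * (1 + s ^ 2)⁻¹) fun r hr => by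
        rw [uIoc_of_le hy] at hr
        simpa using hb (s + r * Complex.I) (by simpa using hr.1.le) (by simpa using hr.2)
    rwa [sub_zero, abs_of_nonneg hy] at this
  have hlim : Tendsto (fun s : ℝ => C * (1 + s ^ 2)⁻¹ * y) atTop (𝓝 0) := by
    have h1 : Tendsto (fun s : ℝ => (1 + s ^ 2)⁻¹) atTop (𝓝 0) :=
      (tendsto_atTop_add_const_left _ 1 (tendsto_pow_atTop two_ne_zero)).inv_tendsto_atTop
    simpa using (h1.const_mul C).mul_const y
  have hR : Tendsto (fun T : ℝ => ∫ r in (0 : ℝ)..y, G (T + r * Complex.I)) atTop (𝓝 0) :=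
    squeeze_zero_norm hside hlim
  have hL : Tendsto (fun T : ℝ => ∫ r in (0 : ℝ)..y, G ((-T : ℝ) + r * Complex.I)) atTop
      (𝓝 0) :=
    squeeze_zero_norm (fun T => by simpa using hside (-T)) hlim
  have hrect : ∀ T : ℝ, (∫ t in -T..T, G t) - (∫ t in -T..T, G (t + y * Complex.I)) +
      Complex.I • (∫ r in (0 : ℝ)..y, G (T + r * Complex.I)) -
      Complex.I • (∫ r in (0 : ℝ)..y, G ((-T : ℝ) + r * Complex.I)) = 0 := by
    intro T
    have := Complex.integral_boundary_rect_eq_zero_of_differentiableOn G (⟨-T, 0⟩ : ℂ)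
      (⟨T, y⟩ : ℂ) fun z hz => by
        have h1 := (Complex.mem_reProdIm.1 hz).2
        rw [uIcc_of_le hy] at h1
        exact (hd z h1.1 h1.2).differentiableWithinAt
    simpa using this
  have e1 : Tendsto (fun T : ℝ => ∫ t in -T..T, G t) atTop (𝓝 (∫ t : ℝ, G t)) :=
    intervalIntegral_tendsto_integral h0 tendsto_neg_atTop_atBot tendsto_id
  have e2 : Tendsto (fun T : ℝ => ∫ t in -T..T, G (t + y * Complex.I)) atTop
      (𝓝 (∫ t : ℝ, G (t + y * Complex.I))) :=
    intervalIntegral_tendsto_integral (hline y hy le_rfl) tendsto_neg_atTop_atBot tendsto_id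
  have e3 := ((e1.sub e2).add (hR.const_smul Complex.I)).sub (hL.const_smul Complex.I)
  simp_rw [hrect] at e3
  have e4 := tendsto_nhds_unique e3 tendsto_const_nhds
  simp only [smul_zero, add_zero, sub_zero] at e4
  exact sub_eq_zero.1 e4

/-- `(z + i)⁻²`, which makes bounded analytic functions in the upper half-plane integrable along
horizontal lines. -/
noncomputable def damping (z : ℂ) : ℂ := ((z + Complex.I) ^ 2)⁻¹

lemma add_I_ne_zero {z : ℂ} (hz : 0 ≤ z.im) : z + Complex.I ≠ 0 := fun h => by
  have := congrArg Complex.im h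
  simp at this
  linarith

lemma norm_damping_le {z : ℂ} (hz : 0 ≤ z.im) : ‖damping z‖ ≤ (1 + z.re ^ 2)⁻¹ := by
  rw [damping, norm_inv, norm_pow, ← Complex.normSq_eq_norm_sq, Complex.normSq_apply]
  refine inv_anti₀ (by positivity) ?_
  simp
  nlinarith

lemma continuous_damping : Continuous fun t : ℝ => damping t := by
  unfold damping
  exact Continuous.inv₀ (by fun_prop) fun t => pow_ne_zero 2 (add_I_ne_zero (by simp))

lemma damping_ne_zero (t : ℝ) : damping t ≠ 0 :=
  inv_ne_zero (pow_ne_zero 2 (add_I_ne_zero (by simp)))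

lemma norm_damping_ofReal_le (t : ℝ) : ‖damping t‖ ≤ (1 + t ^ 2)⁻¹ := by
  simpa using norm_damping_le (z := (t : ℂ)) (by simp)

lemma norm_damping_ofReal_le_one (t : ℝ) : ‖damping t‖ ≤ 1 :=
  (norm_damping_ofReal_le t).trans (inv_le_one_of_one_le₀ (by nlinarith [sq_nonneg t]))

lemma norm_one_sub_exp_le (w : ℂ) : ‖1 - Complex.exp w‖ ≤ Real.exp ‖w‖ - 1 := by
  rw [norm_sub_rev]
  simpa using Complex.norm_exp_sub_sum_le_exp_norm_sub_sum w 1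

/-- The analytic test function `(1 - Ψ(z + iη)) (z + i)⁻²`, where `Ψ = exp (logOuter V)`. The shift
by `η` makes it analytic across the real line. -/
noncomputable def outerTest (V : ℝ → ℝ) (η : ℝ) (z : ℂ) : ℂ :=
  (1 - Complex.exp (logOuter V (z + η * Complex.I))) * damping z

lemma differentiableAt_outerTest {V : ℝ → ℝ} (hc : Continuous V) {ε : ℝ} (hV : ∀ t, |V t| ≤ ε)
    {η : ℝ} (hη : 0 < η) {z : ℂ} (hz : 0 ≤ z.im) :
    DifferentiableAt ℂ (outerTest V η) z := by
  have h1 : DifferentiableAt ℂ (logOuter V) (z + η * Complex.I) :=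
    differentiableAt_logOuter hc hV (by simp; linarith)
  have h2 : DifferentiableAt ℂ (fun z => logOuter V (z + η * Complex.I)) z :=
    DifferentiableAt.comp z (f := fun z => z + η * Complex.I) h1 (by fun_prop)
  refine DifferentiableAt.mul ((differentiableAt_const _).sub h2.cexp) ?_
  exact DifferentiableAt.inv (by fun_prop) (pow_ne_zero 2 (add_I_ne_zero hz))

lemma continuous_outerTest {V : ℝ → ℝ} (hc : Continuous V) {ε : ℝ} (hV : ∀ t, |V t| ≤ ε) {η : ℝ}
    (hη : 0 < η) : Continuous fun t : ℝ => outerTest V η t :=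
  continuous_iff_continuousAt.2 fun t => ContinuousAt.comp (f := fun t : ℝ => (t : ℂ))
    (differentiableAt_outerTest hc hV hη (by simp)).continuousAt (by fun_prop)

lemma norm_outerTest_le {V : ℝ → ℝ} {ε : ℝ} (hV : ∀ t, |V t| ≤ ε) {η : ℝ} {z : ℂ}
    (hz : 0 ≤ z.im) {y : ℝ} (hy : 0 < y) (hyz : y ≤ z.im + η) :
    ‖outerTest V η z‖ ≤ (Real.exp (ε / y) - 1) * (1 + z.re ^ 2)⁻¹ := by
  have hε : 0 ≤ ε := (abs_nonneg _).trans (hV 0)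
  have h1 : ‖logOuter V (z + η * Complex.I)‖ ≤ ε / y := by
    refine (norm_logOuter_le hV (by simp; linarith)).trans ?_
    simp only [Complex.add_im, Complex.mul_im, Complex.ofReal_re, Complex.I_im, mul_one,
      Complex.ofReal_im, Complex.I_re, mul_zero, add_zero]
    gcongr
  have h2 : ‖1 - Complex.exp (logOuter V (z + η * Complex.I))‖ ≤ Real.exp (ε / y) - 1 :=
    (norm_one_sub_exp_le _).trans (by gcongr)
  rw [outerTest, norm_mul]
  exact mul_le_mul h2 (norm_damping_le hz) (norm_nonneg _) ((norm_nonneg _).trans h2)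

lemma norm_outerTest_ofReal_le {V : ℝ → ℝ} {ε : ℝ} (hV : ∀ t, |V t| ≤ ε) {η : ℝ} (hη : 0 < η)
    (t : ℝ) : ‖outerTest V η t‖ ≤ (Real.exp (ε / η) - 1) * (1 + t ^ 2)⁻¹ := by
  simpa using norm_outerTest_le hV (z := t) (by simp) hη (by simp)

lemma integrable_outerTest {V : ℝ → ℝ} (hc : Continuous V) {ε : ℝ} (hV : ∀ t, |V t| ≤ ε) {η : ℝ}
    (hη : 0 < η) : Integrable fun t : ℝ => outerTest V η t :=
  (integrable_inv_one_add_sq.const_mul _).mono'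
    (continuous_outerTest hc hV hη).aestronglyMeasurable
    (ae_of_all _ (norm_outerTest_ofReal_le hV hη))

/-- The Fourier integral of the test function, estimated on the line at height `y`. The bound does
not depend on the shift `η`, and it is here that the size of `V` enters. -/
lemma norm_integral_outerTest_le {V : ℝ → ℝ} (hc : Continuous V) {ε : ℝ} (hV : ∀ t, |V t| ≤ ε)
    {η : ℝ} (hη : 0 < η) (x : ℝ) {y : ℝ} (hy : 0 < y) :
    ‖∫ t : ℝ, outerTest V η t * Complex.exp (-(x * t * Complex.I))‖ ≤
      Real.pi * Real.exp (x * y) * (Real.exp (ε / y) - 1) := by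
  have hε : 0 ≤ ε := (abs_nonneg _).trans (hV 0)
  set G : ℂ → ℂ := fun z => outerTest V η z * Complex.exp (-(x * z * Complex.I)) with hG
  have hexp : ∀ z : ℂ, ‖Complex.exp (-(x * z * Complex.I))‖ = Real.exp (x * z.im) := fun z => by
    rw [Complex.norm_exp]; simp
  have hshift := integral_eq_integral_add_mul_I (G := G) hy.le
    (C := (Real.exp (ε / η) - 1) * Real.exp (|x| * y)) (fun z h1 _ =>
      (differentiableAt_outerTest hc hV hη h1).mul (by fun_prop)) (fun z h1 h2 => by
        rw [hG, norm_mul, hexp, mul_right_comm]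
        have h3 := norm_outerTest_le hV (η := η) h1 hη (by linarith)
        have h4 : x * z.im ≤ |x| * y := mul_le_mul (le_abs_self x) h2 h1 (abs_nonneg x)
        exact mul_le_mul h3 (Real.exp_le_exp.2 h4) (Real.exp_nonneg _)
          ((norm_nonneg _).trans h3))
  change ‖∫ t : ℝ, G t‖ ≤ _
  rw [hshift]
  calc _ ≤ ∫ t : ℝ, Real.exp (x * y) * (Real.exp (ε / y) - 1) * (1 + t ^ 2)⁻¹ := by
        refine norm_integral_le_of_norm_le (integrable_inv_one_add_sq.const_mul _)
          (ae_of_all _ fun t => ?_)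
        have h1 := norm_outerTest_le hV (z := t + y * Complex.I) (by simpa using hy.le) hy
          (by simpa using hη.le)
        rw [hG, norm_mul, hexp]
        simp only [Complex.add_im, Complex.ofReal_im, Complex.mul_im, Complex.ofReal_re,
          Complex.I_im, mul_one, Complex.I_re, mul_zero, add_zero, zero_add, Complex.add_re,
          Complex.mul_re, sub_zero] at h1 ⊢
        calc _ ≤ ((Real.exp (ε / y) - 1) * (1 + t ^ 2)⁻¹) * Real.exp (x * y) := by gcongr
          _ = _ := by ring
    _ = _ := by rw [integral_const_mul, integral_univ_inv_one_add_sq]; ring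

lemma integral_outerTest_eq_zero {V : ℝ → ℝ} (hc : Continuous V) {ε : ℝ} (hV : ∀ t, |V t| ≤ ε)
    {η : ℝ} (hη : 0 < η) {x : ℝ} (hx : x < 0) :
    ∫ t : ℝ, outerTest V η t * Complex.exp (-(x * t * Complex.I)) = 0 := by
  have h1 : Tendsto (fun y : ℝ => Real.pi * Real.exp (x * y) * (Real.exp (ε / y) - 1)) atTop
      (𝓝 (Real.pi * 0 * (Real.exp 0 - 1))) := by
    refine Tendsto.mul (Tendsto.const_mul _ ?_) (Tendsto.sub_const ?_ 1)
    · exact Real.tendsto_exp_atBot.comp (tendsto_id.const_mul_atTop_of_neg hx)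
    · exact (Real.continuous_exp.tendsto 0).comp (tendsto_const_nhds.div_atTop tendsto_id)
  rw [mul_zero, zero_mul] at h1
  refine norm_le_zero_iff.1 (ge_of_tendsto h1 ?_)
  filter_upwards [eventually_gt_atTop 0] with y hy
  exact norm_integral_outerTest_le hc hV hη x hy

/-! ### The Fourier transform on `L²` -/

/-- The Fourier transform on `L²` is the one of tempered distributions. -/
lemma integral_fourier_schwartz_mul (h : Lp ℂ 2 (volume : Measure ℝ)) (s : 𝓢(ℝ, ℂ)) :
    ∫ x, (𝓕 s) x * h x = ∫ x, s x * (𝓕 h : Lp ℂ 2 (volume : Measure ℝ)) x := by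
  have h1 := congrArg (fun T => T s) (Lp.fourier_toTemperedDistribution_eq h)
  simpa only [TemperedDistribution.fourier_apply, Lp.toTemperedDistribution_apply,
    smul_eq_mul] using h1

/-- The pairing formula `∫ f̂ h = ∫ f ĥ` on `L²`. -/
lemma integral_fourier_mul_Lp (f h : Lp ℂ 2 (volume : Measure ℝ)) :
    ∫ x, (𝓕 f : Lp ℂ 2 (volume : Measure ℝ)) x * h x =
      ∫ x, f x * (𝓕 h : Lp ℂ 2 (volume : Measure ℝ)) x := by
  have hconj : ∀ k : Lp ℂ 2 (volume : Measure ℝ), ∃ k' : Lp ℂ 2 (volume : Measure ℝ),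
      ∀ f : Lp ℂ 2 (volume : Measure ℝ), ∫ x, f x * k x = inner ℂ k' f := by
    intro k
    have hk : MemLp (fun x => starRingEnd ℂ (k x)) 2 volume := by
      exact (Lp.memLp k).star
    refine ⟨hk.toLp _, fun f => ?_⟩
    rw [L2.inner_def]
    refine integral_congr_ae ?_
    filter_upwards [hk.coeFn_toLp] with x hx
    rw [hx]
    simp [RCLike.inner_apply]
  obtain ⟨h', hh'⟩ := hconj h
  obtain ⟨k', hk'⟩ := hconj (𝓕 h)
  rw [hh', hk']
  refine DenseRange.induction_on (p := fun f => inner ℂ h' (𝓕 f) = inner ℂ k' f)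
    (SchwartzMap.denseRange_toLpCLM (p := 2) (μ := (volume : Measure ℝ)) (F := ℂ) (E := ℝ)
      ENNReal.ofNat_ne_top) f ?_ ?_
  · exact isClosed_eq (Continuous.inner continuous_const
      (Lp.fourierTransformₗᵢ ℝ ℂ).continuous) (Continuous.inner continuous_const continuous_id)
  · intro s
    rw [← hh', ← hk']
    simp only [SchwartzMap.toLpCLM_apply, SchwartzMap.toLp_fourier_eq]
    calc _ = ∫ x, (𝓕 s) x * h x := by
          refine integral_congr_ae ?_
          filter_upwards [SchwartzMap.coeFn_toLp (𝓕 s) 2] with x hx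
          rw [hx]
      _ = ∫ x, s x * (𝓕 h : Lp ℂ 2 (volume : Measure ℝ)) x := integral_fourier_schwartz_mul h s
      _ = _ := by
          refine integral_congr_ae ?_
          filter_upwards [SchwartzMap.coeFn_toLp s 2] with x hx
          rw [hx]

lemma integral_fourier_mul_of_integrable {f g : ℝ → ℂ} (hf : Integrable f) (hg : Integrable g) :
    ∫ x, 𝓕 f x * g x = ∫ x, f x * 𝓕 g x := by
  have := VectorFourier.integral_fourierIntegral_smul_eq_flip (L := innerₗ ℝ)
    Real.continuous_fourierChar continuous_inner hf hg
  simpa using! this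

/-- A locally integrable function that is orthogonal to all Schwartz functions vanishes. -/
lemma ae_eq_zero_of_forall_schwartz {k : ℝ → ℂ} (hk : LocallyIntegrable k)
    (h : ∀ s : 𝓢(ℝ, ℂ), ∫ x, s x * k x = 0) : ∀ᵐ x, k x = 0 := by
  refine ae_eq_zero_of_integral_contDiff_smul_eq_zero hk fun g hg hgs => ?_
  have h1 : HasCompactSupport (fun x => (g x : ℂ)) := hgs.comp_left (g := Complex.ofReal) rfl
  have h2 : ContDiff ℝ (⊤ : ℕ∞) (fun x => (g x : ℂ)) := Complex.ofRealCLM.contDiff.comp hg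
  rw [← h (h1.toSchwartzMap h2)]
  refine integral_congr_ae (ae_of_all _ fun x => ?_)
  simp

lemma ae_eq_zero_of_fourier_eq_zero {k : ℝ → ℂ} (hk : Integrable k) (h : ∀ x, 𝓕 k x = 0) :
    ∀ᵐ x, k x = 0 := by
  refine ae_eq_zero_of_forall_schwartz hk.locallyIntegrable fun s => ?_
  have h1 := integral_fourier_mul_of_integrable (𝓕⁻ s).integrable hk
  rw [← SchwartzMap.fourier_coe, FourierInvPair.fourier_fourierInv_eq] at h1
  simpa [h] using h1

/-- On `L¹ ∩ L²` the Fourier transform of Plancherel's theorem is given by the integral. -/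
lemma coeFn_fourier_toLp {k : ℝ → ℂ} (hk : Integrable k) (hk2 : MemLp k 2) :
    (𝓕 (hk2.toLp k) : Lp ℂ 2 (volume : Measure ℝ)) =ᵐ[volume] 𝓕 k := by
  have hcont : Continuous (𝓕 k) :=
    VectorFourier.fourierIntegral_continuous Real.continuous_fourierChar continuous_inner hk
  have hdist := integral_fourier_schwartz_mul (hk2.toLp k)
  have hmem : MemLp (𝓕 (hk2.toLp k) : Lp ℂ 2 (volume : Measure ℝ)) 2 volume := Lp.memLp _
  generalize (𝓕 (hk2.toLp k) : Lp ℂ 2 (volume : Measure ℝ)) = p at hdist hmem ⊢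
  have hloc : LocallyIntegrable (fun x => p x) := hmem.locallyIntegrable (by norm_num)
  have h0 := ae_eq_zero_of_forall_schwartz (hloc.sub hcont.locallyIntegrable) fun s => by
    have h1 := hdist s
    have h2 := integral_fourier_mul_of_integrable s.integrable hk
    have h3 : ∫ x, (𝓕 s) x * (hk2.toLp k) x = ∫ x, 𝓕 (s : ℝ → ℂ) x * k x := by
      refine integral_congr_ae ?_
      filter_upwards [hk2.coeFn_toLp] with x hx
      rw [hx, SchwartzMap.fourier_coe]
    have i1 : Integrable fun x => s x * p x :=
      (s.memLp 2).integrable_mul hmem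
    have i2 : Integrable fun x => s x * 𝓕 k x := by
      refine s.integrable.mul_bdd (c := ∫ v, ‖k v‖) hcont.aestronglyMeasurable
        (ae_of_all _ fun x => ?_)
      exact VectorFourier.norm_fourierIntegral_le_integral_norm _ _ _ _ _
    simp only [Pi.sub_apply, mul_sub]
    rw [integral_sub i1 i2, ← h1, h3, h2, sub_self]
  filter_upwards [h0] with x hx
  exact sub_eq_zero.1 hx

/-- The Fourier transform on `L²` squares to the reflection. -/
lemma coeFn_fourier_fourier (f : Lp ℂ 2 (volume : Measure ℝ)) :
    (𝓕 (𝓕 f : Lp ℂ 2 (volume : Measure ℝ)) : Lp ℂ 2 (volume : Measure ℝ)) =ᵐ[volume]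
      fun x => f (-x) := by
  have hdist : ∀ s : 𝓢(ℝ, ℂ), ∫ x, s x * (𝓕 (𝓕 f : Lp ℂ 2 (volume : Measure ℝ)) :
      Lp ℂ 2 (volume : Measure ℝ)) x = ∫ x, s x * f (-x) := fun s => by
    rw [← integral_fourier_schwartz_mul, ← integral_fourier_schwartz_mul,
      ← integral_neg_eq_self]
    refine integral_congr_ae (ae_of_all _ fun x => ?_)
    have h1 : (𝓕 (𝓕 s)) (-x) = s x := by
      rw [SchwartzMap.fourier_coe, ← Real.fourierInv_eq_fourier_neg, ← SchwartzMap.fourierInv_coe,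
        FourierPair.fourierInv_fourier_eq]
    simp only [h1]
  have hmem : MemLp (𝓕 (𝓕 f : Lp ℂ 2 (volume : Measure ℝ)) : Lp ℂ 2 (volume : Measure ℝ)) 2
    volume := Lp.memLp _
  generalize (𝓕 (𝓕 f : Lp ℂ 2 (volume : Measure ℝ)) : Lp ℂ 2 (volume : Measure ℝ)) = p
    at hdist hmem ⊢
  have hf : MemLp (fun x => f (-x)) 2 volume :=
    (Lp.memLp f).comp_measurePreserving (Measure.measurePreserving_neg volume)
  have h0 := ae_eq_zero_of_forall_schwartz
    ((hmem.locallyIntegrable (by norm_num)).sub (hf.locallyIntegrable (by norm_num))) fun s => by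
      simp only [Pi.sub_apply, mul_sub]
      have i1 : Integrable fun x => s x * p x := (s.memLp 2).integrable_mul hmem
      have i2 : Integrable fun x => s x * f (-x) := (s.memLp 2).integrable_mul hf
      rw [integral_sub i1 i2, hdist, sub_self]
  filter_upwards [h0] with x hx
  exact sub_eq_zero.1 hx

/-! ### Orthogonality from one-sided decay -/

/-- The Fourier integral in the angular frequency normalization. -/
noncomputable def angularIntegral (Φ : ℝ → ℂ) (x : ℝ) : ℂ :=
  (((Real.sqrt (2 * Real.pi))⁻¹ : ℝ) : ℂ) * ∫ t : ℝ, Φ t * Complex.exp (-(x * t * Complex.I))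

/-- The function `g` is the Fourier transform of `F` in the weak sense `∫ g Φ = ∫ F Φ̂`. -/
def IsFourierPair (F g : ℝ → ℂ) : Prop :=
  ∀ Φ : ℝ → ℂ, Integrable Φ → MemLp Φ 2 → ∫ t, g t * Φ t = ∫ x, F x * angularIntegral Φ x

lemma norm_exp_neg_mul_I (x t : ℝ) : ‖Complex.exp (-(x * t * Complex.I))‖ = 1 := by
  rw [Complex.norm_exp]; simp

lemma continuous_angularIntegral {Φ : ℝ → ℂ} (hΦ : Integrable Φ) :
    Continuous (angularIntegral Φ) := by
  refine continuous_const.mul (continuous_of_dominated (bound := fun t => ‖Φ t‖) (fun x => ?_)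
    (fun x => ae_of_all _ fun t => ?_) hΦ.norm (ae_of_all _ fun t => by fun_prop))
  · exact hΦ.aestronglyMeasurable.mul (by fun_prop : Continuous _).aestronglyMeasurable
  · rw [norm_mul, norm_exp_neg_mul_I, mul_one]

lemma integrableOn_norm_mul_exp_sqrt_Ioi {F : ℝ → ℂ} (hF : AEStronglyMeasurable F) {c : ℝ}
    (hc : 0 < c) (hdec : HasOneSidedDecay F c) :
    IntegrableOn (fun x => ‖F x‖ * Real.exp (c / 2 * Real.sqrt x)) (Ioi 1) := by
  obtain ⟨C, hC⟩ := hdec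
  set f : ℝ → ℝ := fun x => ‖F x‖ * Real.exp (c / 2 * Real.sqrt x) with hf
  have hmeas : AEStronglyMeasurable f :=
    hF.norm.mul (by fun_prop : Continuous _).aestronglyMeasurable
  refine ⟨hmeas.restrict, ?_⟩
  rw [hasFiniteIntegral_iff_enorm]
  -- On `((j + 1)², (j + 2)²]` the weight is at most `e^{c (j + 2) / 2}`, and the tail of `F` is
  -- `O(e^{-c (j + 1)})`.
  set A : ℕ → Set ℝ := fun j => Ioc (((j : ℝ) + 1) ^ 2) (((j : ℝ) + 2) ^ 2) with hA
  have hcover : Ioi (1 : ℝ) ⊆ ⋃ j, A j := by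
    intro x hx
    have hx0 : (0 : ℝ) ≤ x := le_of_lt (lt_trans one_pos hx)
    have h1 : 1 < Real.sqrt x := by
      rw [Real.lt_sqrt zero_le_one]; simpa using hx
    have h2 : 1 < ⌈Real.sqrt x⌉₊ := Nat.lt_ceil.2 (by simpa using h1)
    obtain ⟨j, hj⟩ : ∃ j, ⌈Real.sqrt x⌉₊ = j + 2 := ⟨_, (Nat.sub_add_cancel h2).symm⟩
    refine mem_iUnion.2 ⟨j, ?_, ?_⟩
    · rw [← Real.lt_sqrt (by positivity)]
      have : j + 1 < ⌈Real.sqrt x⌉₊ := by omega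
      exact_mod_cast Nat.lt_ceil.1 this
    · rw [← Real.sqrt_le_left (by positivity)]
      have := Nat.le_ceil (Real.sqrt x)
      rw [hj] at this
      exact_mod_cast this
  have hpiece : ∀ j, ∫⁻ x in A j, ‖f x‖ₑ ≤
      ENNReal.ofReal (|C| * Real.exp (-(c / 2)) ^ j) := by
    intro j
    calc ∫⁻ x in A j, ‖f x‖ₑ
        ≤ ∫⁻ x in A j, ENNReal.ofReal (Real.exp (c / 2 * (j + 2))) * ‖F x‖ₑ := by
          refine setLIntegral_mono' measurableSet_Ioc fun x hx => ?_
          rw [hf, enorm_mul, enorm_norm, mul_comm]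
          refine mul_le_mul_left ?_ _
          rw [Real.enorm_of_nonneg (Real.exp_nonneg _)]
          refine ENNReal.ofReal_le_ofReal (Real.exp_le_exp.2 ?_)
          refine mul_le_mul_of_nonneg_left ?_ (by positivity)
          exact Real.sqrt_le_iff.2 ⟨by positivity, hx.2⟩
      _ = ENNReal.ofReal (Real.exp (c / 2 * (j + 2))) * ∫⁻ x in A j, ‖F x‖ₑ :=
          lintegral_const_mul' _ _ ENNReal.ofReal_ne_top
      _ ≤ ENNReal.ofReal (Real.exp (c / 2 * (j + 2))) *
            ENNReal.ofReal (|C| * Real.exp (-c * (j + 1))) := by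
          gcongr
          refine (lintegral_mono_set Ioc_subset_Ioi_self).trans
            ((hC _ (by positivity)).trans (ENNReal.ofReal_le_ofReal ?_))
          rw [Real.sqrt_sq (by positivity)]
          gcongr
          exact le_abs_self C
      _ = _ := by
          rw [← ENNReal.ofReal_mul (by positivity), ← Real.exp_nat_mul, mul_left_comm,
            ← Real.exp_add]
          congr 3
          ring
  calc ∫⁻ x in Ioi 1, ‖f x‖ₑ ≤ ∫⁻ x in ⋃ j, A j, ‖f x‖ₑ := lintegral_mono_set hcover
    _ ≤ ∑' j, ∫⁻ x in A j, ‖f x‖ₑ := lintegral_iUnion_le _ _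
    _ ≤ ∑' j : ℕ, ENNReal.ofReal (|C| * Real.exp (-(c / 2)) ^ j) := ENNReal.tsum_le_tsum hpiece
    _ < ⊤ := by
        have hs : Summable fun j : ℕ => |C| * Real.exp (-(c / 2)) ^ j :=
          (summable_geometric_of_lt_one (Real.exp_nonneg _)
            (Real.exp_lt_one_iff.2 (by linarith))).mul_left _
        rw [← ENNReal.ofReal_tsum_of_nonneg (fun j => by positivity) hs]
        exact ENNReal.ofReal_lt_top

/-- One-sided decay in the form in which it is used: half of the exponential rate can be integrated
against `F` on every right half-line. -/
lemma integrableOn_norm_mul_exp_sqrt_add {F : ℝ → ℂ} (hF : MemLp F 2) {c : ℝ} (hc : 0 < c)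
    (hdec : HasOneSidedDecay F c) (s : ℝ) :
    IntegrableOn (fun x => ‖F x‖ * Real.exp (c / 2 * Real.sqrt (x + s))) (Ioi (-s)) := by
  have hcont : Continuous fun x : ℝ => Real.exp (c / 2 * Real.sqrt (x + s)) := by fun_prop
  have h1 : IntegrableOn (fun x => ‖F x‖ * Real.exp (c / 2 * Real.sqrt (x + s)))
      (Icc (-s) 1) :=
    IntegrableOn.mul_continuousOn ((hF.locallyIntegrable (by norm_num)).integrableOn_isCompact
      isCompact_Icc).norm hcont.continuousOn isCompact_Icc
  have h2 : IntegrableOn (fun x => ‖F x‖ * Real.exp (c / 2 * Real.sqrt (x + s))) (Ioi 1) := by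
    refine Integrable.mono' ((integrableOn_norm_mul_exp_sqrt_Ioi hF.1 hc hdec).const_mul
      (Real.exp (c / 2 * Real.sqrt |s|)))
      (hF.1.norm.mul hcont.aestronglyMeasurable).restrict ?_
    filter_upwards [ae_restrict_mem measurableSet_Ioi] with x hx
    have hx0 : (0 : ℝ) ≤ x := le_of_lt (lt_trans one_pos hx)
    rw [Real.norm_of_nonneg (by positivity), mul_left_comm, ← Real.exp_add, ← mul_add]
    gcongr
    calc Real.sqrt (x + s) ≤ Real.sqrt (|s| + x) :=
          Real.sqrt_le_sqrt (by linarith [le_abs_self s])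
      _ ≤ _ := by
          rw [Real.sqrt_le_left (by positivity)]
          nlinarith [Real.sq_sqrt hx0, Real.sq_sqrt (abs_nonneg s),
            mul_nonneg (Real.sqrt_nonneg x) (Real.sqrt_nonneg |s|)]
  refine (h1.union h2).mono_set fun x hx => ?_
  rcases le_or_gt x 1 with h | h
  · exact Or.inl ⟨le_of_lt hx, h⟩
  · exact Or.inr h

/-- The bound `π e^{(c/2)√x}` comes from choosing the height `y = c / (4√x)`. -/
lemma norm_integral_outerTest_le_exp_sqrt {V : ℝ → ℝ} (hV0 : Continuous V) {ε : ℝ}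
    (hV : ∀ t, |V t| ≤ ε) {c : ℝ} (hc : 0 < c) (hε : ε ≤ c ^ 2 / 16)
    {η : ℝ} (hη : 0 < η) {x : ℝ} (hx : 0 < x) :
    ‖∫ t : ℝ, outerTest V η t * Complex.exp (-(x * t * Complex.I))‖ ≤
      Real.pi * Real.exp (c / 2 * Real.sqrt x) := by
  set r := Real.sqrt x with hr
  have hr0 : 0 < r := Real.sqrt_pos.2 hx
  have hrx : r * r = x := Real.mul_self_sqrt hx.le
  have hy : 0 < c / (4 * r) := by positivity
  refine (norm_integral_outerTest_le hV0 hV hη x hy).trans ?_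
  rw [mul_assoc]
  refine mul_le_mul_of_nonneg_left ?_ Real.pi_pos.le
  have h1 : x * (c / (4 * r)) = c / 4 * r := by rw [← hrx]; field_simp
  have h2 : ε / (c / (4 * r)) ≤ c / 4 * r := by
    rw [div_le_iff₀ hy]
    calc ε ≤ c ^ 2 / 16 := hε
      _ = _ := by field_simp; norm_num
  rw [h1]
  calc Real.exp (c / 4 * r) * (Real.exp (ε / (c / (4 * r))) - 1)
      ≤ Real.exp (c / 4 * r) * Real.exp (c / 4 * r) := by
        gcongr
        linarith [Real.exp_le_exp.2 h2]
    _ = _ := by rw [← Real.exp_add]; congr 1; ring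

lemma angularIntegral_outerTest_modulate (V : ℝ → ℝ) (η s x : ℝ) :
    angularIntegral (fun t => outerTest V η t * Complex.exp (-(s * t * Complex.I))) x =
      (((Real.sqrt (2 * Real.pi))⁻¹ : ℝ) : ℂ) *
        ∫ t : ℝ, outerTest V η t * Complex.exp (-((x + s : ℝ) * t * Complex.I)) := by
  unfold angularIntegral
  congr 1
  refine integral_congr_ae (ae_of_all _ fun t => ?_)
  simp only
  rw [mul_assoc, ← Complex.exp_add]
  congr 2
  push_cast
  ring

lemma integrable_outerTest_modulate {V : ℝ → ℝ} (hV0 : Continuous V) {ε : ℝ}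
    (hV : ∀ t, |V t| ≤ ε) {η : ℝ} (hη : 0 < η) (s : ℝ) :
    Integrable fun t : ℝ => outerTest V η t * Complex.exp (-(s * t * Complex.I)) :=
  (integrable_outerTest hV0 hV hη).mul_bdd (c := 1)
    (by fun_prop : Continuous _).aestronglyMeasurable
    (ae_of_all _ fun t => (norm_exp_neg_mul_I s t).le)

lemma memLp_two_of_integrable_of_bdd {Φ : ℝ → ℂ} (h : Integrable Φ) {B : ℝ}
    (hB : ∀ t, ‖Φ t‖ ≤ B) : MemLp Φ 2 := by
  rw [memLp_two_iff_integrable_sq_norm h.aestronglyMeasurable]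
  simp_rw [sq]
  exact h.norm.mul_bdd (c := B) h.aestronglyMeasurable.norm
    (ae_of_all _ fun t => by simpa using hB t)

lemma memLp_outerTest_modulate {V : ℝ → ℝ} (hV0 : Continuous V) {ε : ℝ}
    (hV : ∀ t, |V t| ≤ ε) {η : ℝ} (hη : 0 < η) (s : ℝ) :
    MemLp (fun t : ℝ => outerTest V η t * Complex.exp (-(s * t * Complex.I))) 2 := by
  have hε : 0 ≤ ε := (abs_nonneg _).trans (hV 0)
  refine memLp_two_of_integrable_of_bdd (integrable_outerTest_modulate hV0 hV hη s)
    (B := Real.exp (ε / η) - 1) fun t => ?_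
  rw [norm_mul, norm_exp_neg_mul_I, mul_one]
  refine (norm_outerTest_ofReal_le hV hη t).trans (mul_le_of_le_one_right ?_ ?_)
  · have := Real.one_le_exp (div_nonneg hε hη.le)
    linarith
  · exact inv_le_one_of_one_le₀ (by nlinarith [sq_nonneg t])

/-- If the primitives `V n` tend to zero uniformly, then the test functions become orthogonal to
`g`: on the side of `F`, their transforms live on a right half-line, tend to zero, and are dominated
there thanks to the decay of `F`. -/
lemma tendsto_integral_mul_outerTest {F g : ℝ → ℂ} (hF : MemLp F 2) {c : ℝ} (hc : 0 < c)
    (hdec : HasOneSidedDecay F c) (hpair : IsFourierPair F g) {V : ℕ → ℝ → ℝ}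
    (hV0 : ∀ n, Continuous (V n)) {ε : ℕ → ℝ} (hV : ∀ n t, |V n t| ≤ ε n)
    (hε : Tendsto ε atTop (𝓝 0)) {η : ℕ → ℝ} (hη : ∀ n, 0 < η n) (s : ℝ) :
    Tendsto (fun n => ∫ t : ℝ, g t * (outerTest (V n) (η n) t *
      Complex.exp (-(s * t * Complex.I)))) atTop (𝓝 0) := by
  have hrw : ∀ n, ∫ t : ℝ, g t * (outerTest (V n) (η n) t *
      Complex.exp (-(s * t * Complex.I))) = ∫ x, F x * angularIntegral
        (fun t => outerTest (V n) (η n) t * Complex.exp (-(s * t * Complex.I))) x := fun n =>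
    hpair _ (integrable_outerTest_modulate (hV0 n) (hV n) (hη n) s)
      (memLp_outerTest_modulate (hV0 n) (hV n) (hη n) s)
  simp_rw [hrw]
  set κ : ℝ := (Real.sqrt (2 * Real.pi))⁻¹ with hκ
  have hκ0 : 0 ≤ κ := by positivity
  have hbd := (integrableOn_norm_mul_exp_sqrt_add hF hc hdec s).const_mul (κ * Real.pi)
  have hne : ∀ᵐ x : ℝ, x ≠ -s := by simp [ae_iff]
  rw [← integral_zero (α := ℝ) (G := ℂ) (μ := volume)]
  refine tendsto_integral_filter_of_dominated_convergence
    (bound := (Ioi (-s)).indicator fun x =>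
      κ * Real.pi * (‖F x‖ * Real.exp (c / 2 * Real.sqrt (x + s))))
    (Eventually.of_forall fun n => ?_) ?_
    ((integrable_indicator_iff measurableSet_Ioi).2 hbd) ?_
  · exact hF.1.mul (continuous_angularIntegral
      (integrable_outerTest_modulate (hV0 n) (hV n) (hη n) s)).aestronglyMeasurable
  · have hsmall : ∀ᶠ n in atTop, ε n ≤ c ^ 2 / 16 :=
      (hε.eventually (gt_mem_nhds (by positivity : 0 < c ^ 2 / 16))).mono fun n h => le_of_lt h
    filter_upwards [hsmall] with n hn
    filter_upwards [hne] with x hx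
    rw [angularIntegral_outerTest_modulate, norm_mul, norm_mul, Complex.norm_real,
      Real.norm_of_nonneg hκ0]
    rcases lt_or_gt_of_ne hx with h | h
    · rw [integral_outerTest_eq_zero (hV0 n) (hV n) (hη n) (by linarith : x + s < 0),
        indicator_of_notMem (by simpa using h.le)]
      simp
    · rw [indicator_of_mem (by simpa using h)]
      have := norm_integral_outerTest_le_exp_sqrt (hV0 n) (hV n) hc hn (hη n)
        (by linarith : 0 < x + s)
      calc _ ≤ ‖F x‖ * (κ * (Real.pi * Real.exp (c / 2 * Real.sqrt (x + s)))) := by gcongr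
        _ = _ := by ring
  · filter_upwards with x
    have h1 : Tendsto (fun n => Real.pi * Real.exp ((x + s) * 1) * (Real.exp (ε n / 1) - 1))
        atTop (𝓝 (Real.pi * Real.exp ((x + s) * 1) * (Real.exp (0 / 1) - 1))) :=
      (((Real.continuous_exp.tendsto _).comp (hε.div_const 1)).sub_const 1).const_mul _
    rw [zero_div, Real.exp_zero, sub_self, mul_zero] at h1
    have h2 := squeeze_zero_norm (fun n =>
      norm_integral_outerTest_le (hV0 n) (hV n) (hη n) (x + s) one_pos) h1
    have h3 := (h2.const_mul (κ : ℂ)).const_mul (F x)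
    simp only [mul_zero] at h3
    exact h3.congr fun n => by rw [angularIntegral_outerTest_modulate]

/-! ### Vanishing off the set of local log-integrability -/

lemma integrable_damping : Integrable fun t : ℝ => damping t :=
  integrable_inv_one_add_sq.mono' continuous_damping.aestronglyMeasurable
    (ae_of_all _ norm_damping_ofReal_le)

lemma memLp_damping : MemLp (fun t : ℝ => damping t) 2 :=
  memLp_two_of_integrable_of_bdd integrable_damping norm_damping_ofReal_le_one

/-- The boundary values of the outer function, slightly shifted into the half-plane. -/
noncomputable def shiftedOuter (V : ℝ → ℝ) (η t : ℝ) : ℂ :=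
  Complex.exp (logOuter V (t + η * Complex.I))

lemma norm_shiftedOuter (V : ℝ → ℝ) (η t : ℝ) :
    ‖shiftedOuter V η t‖ = Real.exp (logOuter V (t + η * Complex.I)).re := Complex.norm_exp _

lemma continuous_shiftedOuter {V : ℝ → ℝ} (hc : Continuous V) {ε : ℝ} (hV : ∀ t, |V t| ≤ ε)
    {η : ℝ} (hη : 0 < η) : Continuous (shiftedOuter V η) := by
  refine Complex.continuous_exp.comp (continuous_iff_continuousAt.2 fun t => ?_)
  exact ContinuousAt.comp (f := fun t : ℝ => (t : ℂ) + η * Complex.I)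
    (differentiableAt_logOuter hc hV (by simpa using hη)).continuousAt (by fun_prop)

/-- A small shift makes the modulus of the outer function close to `e^u`, in the `L¹` sense with
respect to an integrable weight. -/
lemma exists_shift {V u k : ℝ → ℝ} {ε K : ℝ} (hc : Continuous V) (hV : ∀ t, |V t| ≤ ε)
    (hL : ∀ s t, |V s - V t| ≤ K * |s - t|) (hum : Measurable u) (hu : ∀ t, u t ≤ K)
    (hder : ∀ᵐ t, HasDerivAt V (u t) t) (hk : Integrable k) {r : ℝ} (hr : 0 < r) :
    ∃ η, 0 < η ∧ Integrable (fun t => k t * |‖shiftedOuter V η t‖ - Real.exp (u t)|) ∧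
      ∫ t, k t * |‖shiftedOuter V η t‖ - Real.exp (u t)| < r := by
  have hmeas : ∀ η > 0, AEStronglyMeasurable
      (fun t => k t * |‖shiftedOuter V η t‖ - Real.exp (u t)|) := fun η hη => by
    have h1 := (continuous_shiftedOuter hc hV hη).measurable
    exact hk.1.mul (by fun_prop : Measurable _).aestronglyMeasurable
  have hbd : ∀ η > 0, ∀ t, ‖k t * |‖shiftedOuter V η t‖ - Real.exp (u t)|‖ ≤
      ‖k t‖ * Real.exp K := fun η hη t => by
    rw [norm_mul, Real.norm_eq_abs |_|, abs_abs]
    refine mul_le_mul_of_nonneg_left ?_ (norm_nonneg _)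
    have h1 : ‖shiftedOuter V η t‖ ≤ Real.exp K := by
      rw [norm_shiftedOuter]
      exact Real.exp_le_exp.2 (re_logOuter_le hc hV hL t hη)
    have h2 := Real.exp_le_exp.2 (hu t)
    have h3 := Real.exp_nonneg (u t)
    have h4 := norm_nonneg (shiftedOuter V η t)
    rw [abs_le]
    constructor <;> linarith
  have hbI : Integrable fun t => ‖k t‖ * Real.exp K := hk.norm.mul_const _
  have hlim : Tendsto (fun η : ℝ => ∫ t, k t * |‖shiftedOuter V η t‖ - Real.exp (u t)|)
      (𝓝[>] 0) (𝓝 (∫ _ : ℝ, (0 : ℝ))) := by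
    refine tendsto_integral_filter_of_dominated_convergence _ ?_ ?_ hbI ?_
    · filter_upwards [self_mem_nhdsWithin] with η hη using hmeas η hη
    · filter_upwards [self_mem_nhdsWithin] with η hη using ae_of_all _ (hbd η hη)
    · filter_upwards [hder] with t ht
      have h1 := (((Real.continuous_exp.tendsto _).comp
        (tendsto_re_logOuter hc hV hL ht)).sub_const (Real.exp (u t))).abs.const_mul (k t)
      rw [sub_self, abs_zero, mul_zero] at h1
      refine h1.congr fun η => ?_
      rw [norm_shiftedOuter]
      rfl
  rw [integral_zero] at hlim
  obtain ⟨η, h1, h2⟩ := ((hlim.eventually (gt_mem_nhds hr)).and self_mem_nhdsWithin).exists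
  exact ⟨η, h2, hbI.mono' (hmeas η h2) (ae_of_all _ (hbd η h2)), h1⟩

/-- Off the compact set `E`, the outer functions tend to `1`. -/
lemma tendsto_shiftedOuter {E : Set ℝ} (hE : IsCompact E) {V : ℕ → ℝ → ℝ}
    (hV : ∀ (n : ℕ) (t : ℝ), |V n t| ≤ ((n : ℝ) + 1)⁻¹)
    (hsupp : ∀ n : ℕ, ∀ t ∉ Metric.cthickening ((n : ℝ) + 1)⁻¹ E, V n t = 0) {η : ℕ → ℝ}
    (hη : ∀ n, 0 < η n) {t : ℝ} (ht : t ∉ E) :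
    Tendsto (fun n => shiftedOuter (V n) (η n) t) atTop (𝓝 1) := by
  obtain ⟨d, hd, hball⟩ := Metric.isOpen_iff.1 hE.isClosed.isOpen_compl t ht
  have hinv : Tendsto (fun n : ℕ => ((n : ℝ) + 1)⁻¹) atTop (𝓝 0) := by
    simpa using tendsto_one_div_add_atTop_nhds_zero_nat (𝕜 := ℝ)
  have h1 : Tendsto (fun n => logOuter (V n) (t + η n * Complex.I)) atTop (𝓝 0) := by
    have h2 : Tendsto (fun n : ℕ => 2 * ((n : ℝ) + 1)⁻¹ / (d / 2)) atTop (𝓝 0) := by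
      simpa using (hinv.const_mul 2).div_const (d / 2)
    refine squeeze_zero_norm' ?_ h2
    filter_upwards [hinv.eventually (gt_mem_nhds (half_pos hd))] with n hn
    refine norm_logOuter_le_of_eq_zero (hV n) (by simpa using hη n) (half_pos hd) fun s hs => ?_
    refine hsupp n s fun hmem => ?_
    rw [hE.cthickening_eq_biUnion_closedBall (by positivity)] at hmem
    obtain ⟨e, he, hse⟩ := mem_iUnion₂.1 hmem
    have hst : dist s t < d / 2 := by simpa [Real.dist_eq] using hs
    refine hball (?_ : e ∈ Metric.ball t d) he
    rw [Metric.mem_ball]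
    rw [Metric.mem_closedBall] at hse
    calc dist e t ≤ dist s e + dist s t := dist_triangle_left _ _ _
      _ < d := by linarith
  have h3 := (Complex.continuous_exp.tendsto 0).comp h1
  rw [Complex.exp_zero] at h3
  exact h3

/-- The deviation of `1 - Ψ` from the indicator function of `E`, with weight `|k|`, in terms of
quantities that tend to zero. Off `E`, only the truncation of `|1 - Ψ|` at `2` is dominated; the
excess is controlled by the modulus. -/
lemma norm_mul_sub_indicator_le {E : Set ℝ} {k Ψ : ℝ → ℂ} {u : ℝ → ℝ} {t q : ℝ} (hq : 0 ≤ q)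
    (h : (t ∉ E ∧ u t = 0) ∨ ‖k t‖ * Real.exp (u t) ≤ q) :
    ‖k t * (1 - Ψ t) - E.indicator k t‖ ≤ ‖k t‖ * |‖Ψ t‖ - Real.exp (u t)| + q +
      Eᶜ.indicator (fun t => ‖k t‖ * min ‖1 - Ψ t‖ 2) t := by
  have hk := norm_nonneg (k t)
  have habs := le_abs_self (‖Ψ t‖ - Real.exp (u t))
  by_cases htE : t ∈ E
  · have h1 : ‖k t‖ * Real.exp (u t) ≤ q := h.resolve_left fun h' => h'.1 htE
    rw [indicator_of_mem htE, indicator_of_notMem (by simpa using htE), mul_sub, mul_one,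
      sub_sub_cancel_left, norm_neg, norm_mul]
    nlinarith
  · rw [indicator_of_notMem htE, indicator_of_mem (by simpa using htE), sub_zero, norm_mul]
    have h2 : ‖k t‖ * (Real.exp (u t) - 1) ≤ q := by
      rcases h with h | h
      · rw [h.2, Real.exp_zero, sub_self, mul_zero]; exact hq
      · nlinarith
    have h3 : ‖1 - Ψ t‖ ≤ 1 + ‖Ψ t‖ := (norm_sub_le _ _).trans (by rw [norm_one])
    have h4 : 0 ≤ ‖k t‖ * |‖Ψ t‖ - Real.exp (u t)| := mul_nonneg hk (abs_nonneg _)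
    rcases le_or_gt ‖1 - Ψ t‖ 2 with h5 | h5
    · rw [min_eq_left h5]; linarith
    · rw [min_eq_right h5.le]
      nlinarith

/-- If `F` decays on one side, then its transform `g` vanishes almost everywhere on a compact set no
point of which has a neighbourhood where `log⁻ |g|` is integrable: the test functions
`(1 - Ψ_n) (t + i)⁻²` tend to `1_E (t + i)⁻²` in `L¹(|g|)`, and `g` is orthogonal to them and to
their modulations in the limit. -/
theorem ae_eq_zero_on_of_lintegral_negLog_eq_top {F g : ℝ → ℂ} (hF : MemLp F 2) {c : ℝ}
    (hc : 0 < c) (hdec : HasOneSidedDecay F c) (hpair : IsFourierPair F g) (hg : Measurable g)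
    (hg2 : MemLp g 2) {E : Set ℝ} (hE : IsCompact E)
    (h : ∀ a b : ℝ, (Ioo a b ∩ E).Nonempty → ∫⁻ t in Ioo a b, negLog g t = ⊤) :
    ∀ᵐ t, t ∈ E → g t = 0 := by
  set k : ℝ → ℂ := fun t => g t * damping t with hk
  have hkI : Integrable k := hg2.integrable_mul memLp_damping
  have hn1 : ∀ n : ℕ, (1 : ℝ) ≤ (n : ℝ) + 1 := fun n => by simp
  choose V u K hK hL hV hsupp hu hum hder hprop using fun n : ℕ =>
    exists_balanced_density_near hg hE h (hn1 n)
  have hVc : ∀ n, Continuous (V n) := fun n => by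
    refine (LipschitzWith.of_dist_le_mul (K := ⟨K n, hK n⟩) fun s t => ?_).continuous
    exact hL n s t
  choose η hη hηI hηr using fun n => exists_shift (hVc n) (hV n) (hL n) (hum n) (hu n) (hder n)
    hkI.norm (by positivity : 0 < ((n : ℝ) + 1)⁻¹)
  have hinv : Tendsto (fun n : ℕ => ((n : ℝ) + 1)⁻¹) atTop (𝓝 0) := by
    simpa using tendsto_one_div_add_atTop_nhds_zero_nat (𝕜 := ℝ)
  set Ψ : ℕ → ℝ → ℂ := fun n => shiftedOuter (V n) (η n) with hΨ
  have hΨc : ∀ n, Continuous (Ψ n) := fun n => continuous_shiftedOuter (hVc n) (hV n) (hη n)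
  -- The three error terms of the pointwise estimate.
  set q : ℝ → ℝ := fun t => ‖damping t‖ + ‖k t‖ with hqdef
  have hqI : Integrable q := integrable_damping.norm.add hkI.norm
  set R : ℕ → ℝ → ℝ := fun n => Eᶜ.indicator fun t => ‖k t‖ * min ‖1 - Ψ n t‖ 2 with hR
  have hRm : ∀ n, AEStronglyMeasurable (R n) := fun n => by
    have h1 := (hΨc n).measurable
    exact (hkI.1.norm.mul (by fun_prop : Measurable _).aestronglyMeasurable).indicator
      hE.isClosed.measurableSet.compl
  have hRb : ∀ n t, ‖R n t‖ ≤ ‖k t‖ * 2 := fun n t => by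
    refine (norm_indicator_le_norm_self _ _).trans ?_
    rw [Real.norm_of_nonneg (by positivity)]
    gcongr
    exact min_le_right _ _
  have hRI : ∀ n, Integrable (R n) := fun n =>
    (hkI.norm.mul_const 2).mono' (hRm n) (ae_of_all _ (hRb n))
  have hRlim : Tendsto (fun n => ∫ t, R n t) atTop (𝓝 0) := by
    rw [← integral_zero (α := ℝ) (G := ℝ) (μ := volume)]
    refine tendsto_integral_of_dominated_convergence _ hRm (hkI.norm.mul_const 2)
      (fun n => ae_of_all _ (hRb n)) (ae_of_all _ fun t => ?_)
    by_cases ht : t ∈ E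
    · simp [hR, ht]
    · have h1 := ((tendsto_shiftedOuter hE hV hsupp hη ht).const_sub 1).norm
      rw [sub_self, norm_zero] at h1
      have h2 := (h1.min (tendsto_const_nhds (x := (2 : ℝ)))).const_mul ‖k t‖
      rw [min_eq_left zero_le_two, mul_zero] at h2
      refine h2.congr fun n => ?_
      simp only [hR, hΨ, indicator_of_mem (show t ∈ Eᶜ from ht)]
  have hdiff : ∀ n, ∀ᵐ t, ‖k t * (1 - Ψ n t) - E.indicator k t‖ ≤
      ‖k t‖ * |‖Ψ n t‖ - Real.exp (u n t)| + Real.exp (-((n : ℝ) + 1)) * q t + R n t := fun n => by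
    filter_upwards [hprop n] with t ht
    refine norm_mul_sub_indicator_le (by positivity) (ht.imp_right fun h' => ?_)
    calc ‖k t‖ * Real.exp (u n t) = ‖damping t‖ * (‖g t‖ * Real.exp (u n t)) := by
          rw [hk, norm_mul]; ring
      _ ≤ ‖damping t‖ * (Real.exp (-((n : ℝ) + 1)) * (1 + ‖g t‖)) :=
          mul_le_mul_of_nonneg_left h' (norm_nonneg _)
      _ = _ := by rw [hqdef]; simp only [hk, norm_mul]; ring
  have hEk : Integrable (E.indicator k) := hkI.indicator hE.isClosed.measurableSet
  have hzero : ∀ s : ℝ, ∫ t, E.indicator k t * Complex.exp (-(s * t * Complex.I)) = 0 := by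
    intro s
    have h1 := tendsto_integral_mul_outerTest hF hc hdec hpair hVc hV hinv hη s
    have hrw : ∀ n t, g t * (outerTest (V n) (η n) t * Complex.exp (-(s * t * Complex.I))) =
        k t * (1 - Ψ n t) * Complex.exp (-(s * t * Complex.I)) := fun n t => by
      simp only [outerTest, hk, hΨ, shiftedOuter]
      ring
    simp_rw [hrw] at h1
    have hexpm : AEStronglyMeasurable fun t : ℝ => Complex.exp (-(s * t * Complex.I)) :=
      (by fun_prop : Continuous _).aestronglyMeasurable
    have hI1 : Integrable fun t => E.indicator k t * Complex.exp (-(s * t * Complex.I)) :=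
      hEk.mul_bdd (c := 1) hexpm (ae_of_all _ fun t => (norm_exp_neg_mul_I s t).le)
    have hbI : ∀ n, Integrable fun t => ‖k t‖ * |‖Ψ n t‖ - Real.exp (u n t)| +
        Real.exp (-((n : ℝ) + 1)) * q t + R n t := fun n =>
      ((hηI n).add (hqI.const_mul _)).add (hRI n)
    have hdI : ∀ n, Integrable fun t => k t * (1 - Ψ n t) - E.indicator k t := fun n => by
      have h2 := (hΨc n).measurable
      exact (hbI n).mono' ((hkI.1.mul (by fun_prop : Measurable _).aestronglyMeasurable).sub hEk.1)
        (hdiff n)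
    have h2 : Tendsto (fun n => ∫ t, (k t * (1 - Ψ n t) - E.indicator k t) *
        Complex.exp (-(s * t * Complex.I))) atTop (𝓝 0) := by
      have h3 : Tendsto (fun n : ℕ => ((n : ℝ) + 1)⁻¹ +
          Real.exp (-((n : ℝ) + 1)) * (∫ t, q t) + ∫ t, R n t) atTop (𝓝 0) := by
        have h4 : Tendsto (fun n : ℕ => Real.exp (-((n : ℝ) + 1))) atTop (𝓝 0) :=
          Real.tendsto_exp_neg_atTop_nhds_zero.comp
            (tendsto_atTop_add_const_right _ 1 tendsto_natCast_atTop_atTop)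
        simpa using (hinv.add (h4.mul_const _)).add hRlim
      refine squeeze_zero_norm (fun n => ?_) h3
      calc _ ≤ ∫ t, (‖k t‖ * |‖Ψ n t‖ - Real.exp (u n t)| +
            Real.exp (-((n : ℝ) + 1)) * q t + R n t) := by
            refine norm_integral_le_of_norm_le (hbI n) ?_
            filter_upwards [hdiff n] with t ht
            rwa [norm_mul, norm_exp_neg_mul_I, mul_one]
        _ = (∫ t, ‖k t‖ * |‖Ψ n t‖ - Real.exp (u n t)|) +
            Real.exp (-((n : ℝ) + 1)) * (∫ t, q t) + ∫ t, R n t := by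
            have i1 : Integrable fun t => ‖k t‖ * |‖Ψ n t‖ - Real.exp (u n t)| := hηI n
            have i2 : Integrable fun t => Real.exp (-((n : ℝ) + 1)) * q t := hqI.const_mul _
            have i3 : Integrable fun t => ‖k t‖ * |‖Ψ n t‖ - Real.exp (u n t)| +
              Real.exp (-((n : ℝ) + 1)) * q t := i1.add i2
            rw [integral_add i3 (hRI n), integral_add i1 i2, integral_const_mul]
        _ ≤ _ := by
            have := (hηr n).le
            gcongr
    have h5 := h1.sub h2
    have h6 : ∀ n, (∫ t, k t * (1 - Ψ n t) * Complex.exp (-(s * t * Complex.I))) -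
        (∫ t, (k t * (1 - Ψ n t) - E.indicator k t) * Complex.exp (-(s * t * Complex.I))) =
        ∫ t, E.indicator k t * Complex.exp (-(s * t * Complex.I)) := fun n => by
      have h7 := (hdI n).mul_bdd (c := 1) hexpm
        (ae_of_all _ fun t => (norm_exp_neg_mul_I s t).le)
      have h8 : ∫ t, k t * (1 - Ψ n t) * Complex.exp (-(s * t * Complex.I)) =
          ∫ t, ((k t * (1 - Ψ n t) - E.indicator k t) * Complex.exp (-(s * t * Complex.I)) +
            E.indicator k t * Complex.exp (-(s * t * Complex.I))) :=
        integral_congr_ae (ae_of_all _ fun t => by simp only; ring)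
      rw [h8, integral_add h7 hI1, add_sub_cancel_left]
    simp_rw [h6, sub_zero] at h5
    exact tendsto_nhds_unique tendsto_const_nhds h5
  have hfin : ∀ᵐ t, E.indicator k t = 0 := by
    refine ae_eq_zero_of_fourier_eq_zero hEk fun x => ?_
    rw [Real.fourier_eq', ← hzero (2 * Real.pi * x)]
    refine integral_congr_ae (ae_of_all _ fun t => ?_)
    simp only [smul_eq_mul]
    rw [mul_comm]
    congr 2
    simp only [RCLike.inner_apply, conj_trivial]
    push_cast
    ring
  filter_upwards [hfin] with t ht htE
  rw [indicator_of_mem htE] at ht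
  exact (mul_eq_zero.1 ht).resolve_right (damping_ne_zero t)

/-! ### Transfer to the angular Fourier transform -/

lemma measurable_angularFourier (f : Lp ℂ 2 (volume : Measure ℝ)) :
    Measurable (angularFourier f) := by
  have h := (Lp.stronglyMeasurable (𝓕 f : Lp ℂ 2 (volume : Measure ℝ))).measurable
  unfold angularFourier
  fun_prop

lemma memLp_angularFourier (f : Lp ℂ 2 (volume : Measure ℝ)) : MemLp (angularFourier f) 2 := by
  have h := Lp.memLp (𝓕 f : Lp ℂ 2 (volume : Measure ℝ))
  have h1 : MemLp (fun x : ℝ => (𝓕 f : Lp ℂ 2 (volume : Measure ℝ)) (x / (2 * Real.pi))) 2 := by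
    have hm := (Lp.stronglyMeasurable (𝓕 f : Lp ℂ 2 (volume : Measure ℝ))).measurable
    rw [memLp_two_iff_integrable_sq_norm (by fun_prop : Measurable _).aestronglyMeasurable]
    rw [memLp_two_iff_integrable_sq_norm h.1] at h
    exact h.comp_div (by positivity)
  exact h1.const_mul _

lemma fourier_eq_integral_angular (Φ : ℝ → ℂ) (x : ℝ) :
    𝓕 Φ x = ∫ t : ℝ, Φ t * Complex.exp (-((2 * Real.pi * x : ℝ) * t * Complex.I)) := by
  rw [Real.fourier_eq']
  refine integral_congr_ae (ae_of_all _ fun t => ?_)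
  simp only [smul_eq_mul, RCLike.inner_apply, conj_trivial]
  rw [mul_comm]
  congr 2
  push_cast
  ring

lemma angular_const_mul_self :
    2 * Real.pi * ((Real.sqrt (2 * Real.pi))⁻¹ * (Real.sqrt (2 * Real.pi))⁻¹) = 1 := by
  rw [← mul_inv, Real.mul_self_sqrt (by positivity)]
  exact mul_inv_cancel₀ (by positivity)

lemma isFourierPair_angularFourier (f : Lp ℂ 2 (volume : Measure ℝ)) :
    IsFourierPair f (angularFourier f) := by
  intro Φ hΦ hΦ2
  have hpi : 2 * Real.pi ≠ 0 := by positivity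
  set Φ' : ℝ → ℂ := fun ξ => Φ (2 * Real.pi * ξ) with hΦ'
  have h1 : Integrable Φ' := hΦ.comp_mul_left' hpi
  have h2 : MemLp Φ' 2 := by
    rw [memLp_two_iff_integrable_sq_norm h1.1]
    exact ((memLp_two_iff_integrable_sq_norm hΦ.1).1 hΦ2).comp_mul_left' hpi
  have h3 : ∀ x, (2 * Real.pi : ℝ) * 𝓕 Φ' x =
      ∫ t : ℝ, Φ t * Complex.exp (-(x * t * Complex.I)) := fun x => by
    have := Measure.integral_comp_mul_left
      (fun t : ℝ => Φ t * Complex.exp (-(x * t * Complex.I))) (2 * Real.pi)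
    rw [abs_of_pos (by positivity), Complex.real_smul] at this
    rw [fourier_eq_integral_angular]
    have h4 : ∫ t : ℝ, Φ' t * Complex.exp (-((2 * Real.pi * x : ℝ) * t * Complex.I)) =
        ∫ t : ℝ, Φ (2 * Real.pi * t) *
          Complex.exp (-(x * ((2 * Real.pi * t : ℝ) : ℂ) * Complex.I)) := by
      refine integral_congr_ae (ae_of_all _ fun t => ?_)
      simp only [hΦ']
      congr 3
      push_cast
      ring
    rw [h4, this, ← mul_assoc, ← Complex.ofReal_mul, mul_inv_cancel₀ hpi, Complex.ofReal_one,
      one_mul]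
  have h5 := integral_fourier_mul_Lp f (h2.toLp Φ')
  set κ : ℝ := (Real.sqrt (2 * Real.pi))⁻¹ with hκ
  calc ∫ t, angularFourier f t * Φ t
      = ∫ t, (fun ξ => (κ : ℂ) * ((𝓕 f : Lp ℂ 2 (volume : Measure ℝ)) ξ * Φ' ξ))
          (t / (2 * Real.pi)) := by
        refine integral_congr_ae (ae_of_all _ fun t => ?_)
        simp only [angularFourier, hΦ', mul_div_cancel₀ t hpi, ← hκ]
        rw [mul_assoc]
    _ = (2 * Real.pi : ℝ) * (κ * ∫ ξ, (𝓕 f : Lp ℂ 2 (volume : Measure ℝ)) ξ * Φ' ξ) := by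
        rw [Measure.integral_comp_div
          (fun ξ => (κ : ℂ) * ((𝓕 f : Lp ℂ 2 (volume : Measure ℝ)) ξ * Φ' ξ)),
          abs_of_pos (by positivity), integral_const_mul, Complex.real_smul]
    _ = (2 * Real.pi : ℝ) * (κ * ∫ x, f x * 𝓕 Φ' x) := by
        congr 2
        calc _ = ∫ ξ, (𝓕 f : Lp ℂ 2 (volume : Measure ℝ)) ξ * (h2.toLp Φ') ξ := by
              refine integral_congr_ae ?_
              filter_upwards [h2.coeFn_toLp] with x hx
              rw [hx]
          _ = _ := h5
          _ = _ := by
              refine integral_congr_ae ?_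
              filter_upwards [coeFn_fourier_toLp h1 h2] with x hx
              rw [hx]
    _ = _ := by
        rw [← mul_assoc, ← integral_const_mul]
        refine integral_congr_ae (ae_of_all _ fun x => ?_)
        simp only [angularIntegral, ← h3]
        rw [← hκ]
        ring

lemma isFourierPair_reflection (f : Lp ℂ 2 (volume : Measure ℝ)) :
    IsFourierPair (angularFourier f) (fun x => f (-x)) := by
  intro Φ hΦ hΦ2
  have hpi : 2 * Real.pi ≠ 0 := by positivity
  set κ : ℝ := (Real.sqrt (2 * Real.pi))⁻¹ with hκ
  have h5 := integral_fourier_mul_Lp (𝓕 f) (hΦ2.toLp Φ)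
  symm
  calc ∫ x, angularFourier f x * angularIntegral Φ x
      = ∫ x, (fun ξ => (κ * κ : ℂ) * ((𝓕 f : Lp ℂ 2 (volume : Measure ℝ)) ξ * 𝓕 Φ ξ))
          (x / (2 * Real.pi)) := by
        refine integral_congr_ae (ae_of_all _ fun x => ?_)
        simp only [angularFourier, angularIntegral, fourier_eq_integral_angular,
          mul_div_cancel₀ x hpi, ← hκ]
        ring
    _ = (2 * Real.pi : ℝ) * ((κ * κ : ℂ) *
          ∫ ξ, (𝓕 f : Lp ℂ 2 (volume : Measure ℝ)) ξ * 𝓕 Φ ξ) := by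
        rw [Measure.integral_comp_div
          (fun ξ => (κ * κ : ℂ) * ((𝓕 f : Lp ℂ 2 (volume : Measure ℝ)) ξ * 𝓕 Φ ξ)),
          abs_of_pos (by positivity), integral_const_mul, Complex.real_smul]
    _ = ∫ ξ, (𝓕 f : Lp ℂ 2 (volume : Measure ℝ)) ξ * 𝓕 Φ ξ := by
        rw [← mul_assoc, ← Complex.ofReal_mul, ← Complex.ofReal_mul, angular_const_mul_self,
          Complex.ofReal_one, one_mul]
    _ = ∫ ξ, (𝓕 f : Lp ℂ 2 (volume : Measure ℝ)) ξ *
          (𝓕 (hΦ2.toLp Φ) : Lp ℂ 2 (volume : Measure ℝ)) ξ := by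
        refine integral_congr_ae ?_
        filter_upwards [coeFn_fourier_toLp hΦ hΦ2] with x hx
        rw [hx]
    _ = _ := h5.symm
    _ = ∫ x, f (-x) * Φ x := by
        refine integral_congr_ae ?_
        filter_upwards [coeFn_fourier_fourier f, hΦ2.coeFn_toLp] with x hx1 hx2
        rw [hx1, hx2]

lemma bot_lt_logIntegral {g : ℝ → ℂ} {I : Set ℝ} (h : ∫⁻ t in I, negLog g t < ⊤) :
    ⊥ < logIntegral g I := by
  unfold logIntegral
  change _ < _ - ((∫⁻ t in I, negLog g t : ℝ≥0∞) : EReal)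
  rw [sub_eq_add_neg, EReal.bot_lt_add_iff]
  refine ⟨lt_of_lt_of_le EReal.bot_lt_zero (EReal.coe_ennreal_nonneg _), ?_⟩
  rw [bot_lt_iff_ne_bot, Ne, EReal.neg_eq_bot_iff, EReal.coe_ennreal_eq_top_iff]
  exact h.ne

/-- If `g` vanishes where `log |g|` is nowhere locally integrable, then the open set on which
`log |g|` is locally integrable carries `g`. -/
lemma exists_isOpen_ae_eq_livingSet {g : ℝ → ℂ} (hg : Measurable g)
    (hz : ∀ E : Set ℝ, IsCompact E →
      (∀ a b : ℝ, (Ioo a b ∩ E).Nonempty → ∫⁻ t in Ioo a b, negLog g t = ⊤) →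
      ∀ᵐ t, t ∈ E → g t = 0) :
    ∃ U : Set ℝ, IsOpen U ∧ U =ᵐ[volume] livingSet g ∧
      ∀ x ∈ U, ∃ a b : ℝ, x ∈ Ioo a b ∧ ⊥ < logIntegral g (Ioo a b) := by
  set U : Set ℝ := {x | ∃ a b : ℝ, x ∈ Ioo a b ∧ ∫⁻ t in Ioo a b, negLog g t < ⊤} with hU
  have hopen : IsOpen U := by
    refine isOpen_iff_mem_nhds.2 fun x hx => ?_
    obtain ⟨a, b, hab, hfin⟩ := hx
    exact mem_of_superset (isOpen_Ioo.mem_nhds hab) fun y hy => ⟨a, b, hy, hfin⟩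
  refine ⟨U, hopen, ?_, fun x hx => ?_⟩
  · have h1 : ∀ᵐ t, t ∉ U → g t = 0 := by
      have h2 : ∀ n : ℕ, ∀ᵐ t, t ∈ Uᶜ ∩ Metric.closedBall 0 n → g t = 0 := fun n => by
        refine hz _ ((isCompact_closedBall 0 (n : ℝ)).inter_left hopen.isClosed_compl) ?_
        rintro a b ⟨t, hab, htU, -⟩
        by_contra hne
        exact htU ⟨a, b, hab, lt_top_iff_ne_top.2 hne⟩
      filter_upwards [ae_all_iff.2 h2] with t ht htU
      obtain ⟨n, hn⟩ := exists_nat_ge ‖t‖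
      exact ht n ⟨htU, by simpa using hn⟩
    have h2 : ∀ᵐ t, t ∈ U → g t ≠ 0 := by
      have h3 : volume {t | t ∈ U ∧ g t = 0} = 0 := by
        refine measure_null_of_locally_null _ ?_
        rintro x ⟨⟨a, b, hab, hfin⟩, -⟩
        refine ⟨{t | t ∈ Ioo a b ∧ g t = 0}, ?_, ?_⟩
        · rw [mem_nhdsWithin]
          exact ⟨Ioo a b, isOpen_Ioo, hab, fun t ht => ⟨ht.1, ht.2.2⟩⟩
        · have h4 := ae_lt_top (measurable_negLog hg) hfin.ne
          rw [ae_restrict_iff' measurableSet_Ioo] at h4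
          refine measure_mono_null ?_ h4
          rintro t ⟨ht1, ht2⟩ hlt
          exact absurd (hlt ht1) (by simp [negLog, ht2])
      filter_upwards [measure_eq_zero_iff_ae_notMem.1 h3] with t ht htU h0
      exact ht ⟨htU, h0⟩
    filter_upwards [h1, h2] with t ht1 ht2
    refine propext ⟨fun htU => norm_pos_iff.2 (ht2 htU), fun htl => ?_⟩
    by_contra htU
    exact norm_pos_iff.1 htl (ht1 htU)
  · obtain ⟨a, b, hab, hfin⟩ := hx
    exact ⟨a, b, hab, bot_lt_logIntegral hfin⟩

lemma setLIntegral_negLog_reflection (f : ℝ → ℂ) (a b : ℝ) :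
    ∫⁻ t in Ioo a b, negLog (fun x => f (-x)) t = ∫⁻ t in Ioo (-b) (-a), negLog f t := by
  have h := (Measure.measurePreserving_neg (volume : Measure ℝ)).setLIntegral_comp_preimage_emb
    (MeasurableEquiv.neg ℝ).measurableEmbedding (negLog f) (Ioo (-b) (-a))
  rw [← h]
  simp [negLog]

theorem mainTheorem1 :
    (∀ (f : Lp ℂ 2 (volume : Measure ℝ)) (c : ℝ), 0 < c →
      HasOneSidedDecay f c →
      ∃ U : Set ℝ, IsOpen U ∧ U =ᵐ[volume] spectrumSet f ∧
        ∀ x ∈ U, ∃ a b : ℝ, x ∈ Ioo a b ∧ ⊥ < logIntegral (angularFourier f) (Ioo a b)) ∧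
    (∀ (f : Lp ℂ 2 (volume : Measure ℝ)) (c : ℝ), 0 < c →
      HasOneSidedDecay (angularFourier f) c →
      ∃ U : Set ℝ, IsOpen U ∧ U =ᵐ[volume] livingSet f ∧
        ∀ x ∈ U, ∃ a b : ℝ, x ∈ Ioo a b ∧ ⊥ < logIntegral f (Ioo a b)) := by
  refine ⟨fun f c hc hdec => ?_, fun f c hc hdec => ?_⟩
  · exact exists_isOpen_ae_eq_livingSet (measurable_angularFourier f) fun E hE h =>
      ae_eq_zero_on_of_lintegral_negLog_eq_top (Lp.memLp f) hc hdec
        (isFourierPair_angularFourier f) (measurable_angularFourier f) (memLp_angularFourier f)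
        hE h
  · have hmeas := (Lp.stronglyMeasurable f).measurable
    refine exists_isOpen_ae_eq_livingSet hmeas fun E hE h => ?_
    -- The transform of `angularFourier f` is the reflection of `f`.
    have h1 := ae_eq_zero_on_of_lintegral_negLog_eq_top (memLp_angularFourier f) hc hdec
      (isFourierPair_reflection f) (hmeas.comp measurable_neg)
      ((Lp.memLp f).comp_measurePreserving (Measure.measurePreserving_neg volume))
      (E := Neg.neg '' E) (hE.image continuous_neg) (by
        rintro a b ⟨-, hab, t, ht, rfl⟩
        rw [setLIntegral_negLog_reflection]
        exact h _ _ ⟨t, ⟨by linarith [hab.2], by linarith [hab.1]⟩, ht⟩)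
    have h2 := (Measure.measurePreserving_neg (volume : Measure ℝ)).quasiMeasurePreserving.ae h1
    filter_upwards [h2] with t ht htE
    simpa using ht ⟨t, htE, rfl⟩
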